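/- Let $k$ be a number field of degree $n=r_1+2r_2$ with $r_1$ real embeddings and $r_2$ pairs of complex conjugate embeddings; let $\tau_{r_1+1},\dots,\tau_{r_1+r_2}$ be complex embeddings, one from each pair, and write $\gamma^{(r_1+j)}=\tau_{r_1+j}(\gamma)$. Put $r=r_1+r_2-1$ (so $n-1=r+r_2$), let $\varepsilon_1,\dots,\varepsilon_r$ be independent totally positive units of $k$ (positive at every real embedding), and let $N_1,\dots,N_{r_2}\ge 3$ be integers. Arguments are taken in $(-\pi,\pi]$. **Ordered complexes and $\Lambda$-complexes.** An ordered $p$-complex $X=\bigcup_{\alpha\in\mathfrak I}X_\alpha$ in a $p$-dimensional real vector space $V$ is a family of $p$-simplices $X_\alpha\subset V$ (convex hulls of sets $\mathrm{Vt}(X_\alpha)$ of $p+1$ affinely independent vertices), each with a strict total order $\prec_\alpha$ on $\mathrm{Vt}(X_\alpha)$. For $x\in X_\alpha$, $\mathrm{SpVt}(x)$ is the set of vertices of $X_\alpha$ with positive coefficient in the barycentric expansion of $x$. For a full lattice $\Lambda\subset V$ (a discrete subgroup spanning $V$ over $\mathbb R$), $X$ is a $\Lambda$-complex if: (1) $X_\alpha\cap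 X_\beta$ is empty or the convex hull of $\mathrm{Vt}(X_\alpha)\cap\mathrm{Vt}(X_\beta)$, for all $\alpha,\beta\in\mathfrak I$ (so $\mathrm{SpVt}(x)$ does not depend on the simplex containing $x$); (2) $\prec_\alpha$ and $\prec_\beta$ agree on $\mathrm{Vt}(X_\alpha)\cap\mathrm{Vt}(X_\beta)$; (3) if $\lambda\in\Lambda$, $v,w\in\mathrm{Vt}(X_\alpha)$ and $v+\lambda,w+\lambda\in\mathrm{Vt}(X_{\alpha'})$, then $v\prec_\alpha w\iff v+\lambda\prec_{\alpha'}w+\lambda$; (4) the quotient map $V\to V/\Lambda$ is surjective on $X$ and injective on the union of the interiors of the $X_\alpha$; (5) if $x,x+\lambda\in X$ with $\lambda\in\Lambda$, then $\mathrm{SpVt}(x+\lambda)=\mathrm{SpVt}(x)+\lambda$. **Raising the dimension.** Given an ordered $p$-complex $X$ in $V$, a linear form $\omega:V\to\mathbb R$ and integers $M_1<M_2$, let $A(u)\in(0,1]$ be defined by $A(u)-\omega(u)\in\mathbb Z$, and let $u\prec_\alpha^A u'$ mean that $A(u)<A(u')$, or $A(u)=A(u')$ and $u\prec_\alpha u'$.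 The complex $Y(X,\omega,[M_1,M_2])$ in $V\times\mathbb R$ is indexed by the triples $\gamma=(\alpha,v,\ell)$ with $\alpha\in\mathfrak I$, $v\in\mathrm{Vt}(X_\alpha)$, $\ell\in\mathbb Z$, $M_1\le\ell<M_2$. If $v_0\prec_\alpha^A\cdots\prec_\alpha^A v_p$ are the vertices of $X_\alpha$ and $v=v_j$, the vertices of $Y_\gamma$ are $v_i\times(A(v_i)-\omega(v_i)+\ell)$ for $0\le i\le j$ and $v_i\times(A(v_i)-\omega(v_i)+\ell-1)$ for $j\le i\le p$. They are ordered by: $s\times t\prec_\gamma s'\times t'$ if and only if $s\prec_\alpha s'$, or $s=s'$ and $t'<t$. **The complex $\mathfrak X$.** Let $X_0$ be the one-point complex $\{0\}=\mathbb R^0$, let $X_j=Y(X_{j-1},0,[0,1])$ for $1\le j\le r$, and let $X_{r+j}=Y(X_{r+j-1},\omega_{r+j-1},[0,N_j])$ for $1\le j\le r_2$, where $$\omega_{r+j-1}(x)=\frac{N_j}{2\pi}\sum_{\ell=1}^r x[\ell]\arg\big(\varepsilon_\ell^{(r_1+j)}\big)\qquad(x\in\mathbb R^{r+j-1}).$$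 Put $\mathfrak X=\bigcup_{\alpha\in\mathfrak I}\mathfrak X_\alpha:=X_{n-1}\subset\mathbb R^{n-1}$. **Proposition.** $\mathfrak X$ is a $\Lambda$-complex for $\Lambda=\mathbb Z^r\times N_1\mathbb Z\times\cdots\times N_{r_2}\mathbb Z\subset\mathbb Z^{n-1}$. Moreover: (i) $\mathrm{Vt}(\mathfrak X_\alpha)\subset\mathbb Z^{n-1}$ for all $\alpha\in\mathfrak I$. (ii) There are $|\mathfrak I|=(n-1)!\prod_{j=1}^{r_2}N_j$ simplices $\mathfrak X_\alpha$, and they are pairwise distinct. (iii) For each $1\le j\le r_2$ and each $\alpha\in\mathfrak I$ there is $\alpha_j\in\mathbb R$ such that $\alpha_j\le\Omega_j(\kappa)\le\alpha_j+1$ for all $\kappa\in\mathfrak X_\alpha$, where $$\Omega_j(\kappa)=\kappa[r+j]+\frac{N_j}{2\pi}\sum_{\ell=1}^r\kappa[\ell]\arg\big(\varepsilon_\ell^{(r_1+j)}\big).$$ -/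

import Mathlib

/-- The data of an ordered complex `X = ⋃_α X_α` in a real vector space `V`: an index set, for each
index `α` the finite vertex set `Vt(X_α)`, and for each `α` the order relation `≺_α` (only its
values on `Vt(X_α)` matter).  That these data really consist of ordered simplices of full dimension
is the predicate `OrderedComplex.IsOrdered` below. -/
structure OrderedComplex (V : Type) where
  /-- the index set of the simplices -/
  Index : Type
  /-- the vertex set of a simplex -/
  vt : Index → Finset V
  /-- the strict order on the vertices of a simplex -/
  lt : Index → V → V → Prop

/-- The simplex `X_α`, as a point set: the convex hull of its vertices. -/
def OrderedComplex.simplex {V : Type} [AddCommGroup V] [Module ℝ V]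
    (X : OrderedComplex V) (α : X.Index) : Set V :=
  convexHull ℝ (X.vt α : Set V)

/-- The underlying point set `⋃_α X_α`. -/
def OrderedComplex.carrier {V : Type} [AddCommGroup V] [Module ℝ V]
    (X : OrderedComplex V) : Set V :=
  ⋃ α, X.simplex α

/-- `X` is an ordered `p`-complex in the `p`-dimensional space `V`: each `X_α` is a `p`-simplex
(`p + 1` affinely independent vertices) and `≺_α` is a strict total order on its vertices. -/
structure OrderedComplex.IsOrdered {V : Type} [AddCommGroup V] [Module ℝ V]
    (X : OrderedComplex V) : Prop where
  affineIndependent : ∀ α, AffineIndependent ℝ (fun v : {v // v ∈ X.vt α} => (v : V))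
  card_vt : ∀ α, (X.vt α).card = Module.finrank ℝ V + 1
  irrefl : ∀ α, ∀ u ∈ X.vt α, ¬ X.lt α u u
  trans : ∀ α, ∀ u ∈ X.vt α, ∀ v ∈ X.vt α, ∀ w ∈ X.vt α,
    X.lt α u v → X.lt α v w → X.lt α u w
  total : ∀ α, ∀ u ∈ X.vt α, ∀ v ∈ X.vt α, X.lt α u v ∨ u = v ∨ X.lt α v u

/-- The spanning vertices of `x` with respect to the simplex with vertex set `S`: the vertices
having a positive coefficient in the barycentric expansion of `x`. -/
def spanningVertices {V : Type} [AddCommGroup V] [Module ℝ V] (S : Finset V) (x : V) : Set V :=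
  {v | v ∈ S ∧ ∃ t : V → ℝ, (∀ u ∈ S, 0 ≤ t u) ∧ ∑ u ∈ S, t u = 1 ∧
    ∑ u ∈ S, t u • u = x ∧ 0 < t v}

/-- `X` is a `Λ`-complex in `V`. -/
structure OrderedComplex.IsLambdaComplex {V : Type} [NormedAddCommGroup V] [NormedSpace ℝ V]
    (X : OrderedComplex V) (Λ : AddSubgroup V) : Prop where
  /-- `Λ` is a full lattice: it is discrete ... -/
  discrete : DiscreteTopology Λ
  /-- ... and spans `V` over the reals. -/
  span_eq_top : Submodule.span ℝ (Λ : Set V) = ⊤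
  /-- `X` is an ordered `p`-complex, where `p = dim V`. -/
  isOrdered : X.IsOrdered
  /-- Simplices intersect along common faces (`convexHull ℝ ∅ = ∅`). -/
  simplicial : ∀ α β, X.simplex α ∩ X.simplex β =
    convexHull ℝ ((X.vt α : Set V) ∩ (X.vt β : Set V))
  /-- The orders are compatible. -/
  compatible : ∀ α β, ∀ v w, v ∈ X.vt α → v ∈ X.vt β → w ∈ X.vt α → w ∈ X.vt β →
    (X.lt α v w ↔ X.lt β v w)
  /-- The orders are `Λ`-invariant. -/
  invariant : ∀ α α', ∀ v ∈ X.vt α, ∀ w ∈ X.vt α, ∀ l ∈ Λ, v + l ∈ X.vt α' → w + l ∈ X.vt α' →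
    (X.lt α v w ↔ X.lt α' (v + l) (w + l))
  /-- `X` maps onto `V / Λ` ... -/
  surjOn : Set.SurjOn (QuotientAddGroup.mk : V → V ⧸ Λ) X.carrier Set.univ
  /-- ... and the union of the interiors of its simplices maps injectively to `V / Λ`. -/
  injOn : Set.InjOn (QuotientAddGroup.mk : V → V ⧸ Λ) (⋃ α, interior (X.simplex α))
  /-- Spanning vertices are `Λ`-equivariant.  (They do not depend on the simplex containing the
  point, as `X` is simplicial, so every choice of simplices is allowed here.) -/
  equivariant : ∀ α β, ∀ x ∈ X.simplex α, ∀ l ∈ Λ, x + l ∈ X.simplex β →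
    spanningVertices (X.vt β) (x + l) = (fun v => v + l) '' spanningVertices (X.vt α) x

/-- The upper fractional part of a real number `x`. -/
noncomputable def upperFract (x : ℝ) : ℝ := x - ⌈x⌉ + 1

/-- `upperFract x` is the unique `a` in `(0, 1]` such that `a - x` is an integer. -/
theorem upperFract_eq_iff (x a : ℝ) :
    upperFract x = a ↔ (∃ m : ℤ, a - x = m) ∧ 0 < a ∧ a ≤ 1 := by
  unfold upperFract
  constructor
  · rintro rfl
    refine ⟨⟨1 - ⌈x⌉, by push_cast; ring⟩, ?_, ?_⟩
    · linarith [Int.ceil_lt_add_one x]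
    · linarith [Int.le_ceil x]
  · rintro ⟨⟨m, hm⟩, h0, h1⟩
    have : ⌈x⌉ = 1 - m := by
      rw [Int.ceil_eq_iff]; push_cast; constructor <;> linarith
    rw [this]; push_cast; linarith

/-- The modified order `≺_α^A`, where `A` is the upper fractional part of `ω`. -/
def OrderedComplex.ltA {V : Type} (X : OrderedComplex V) (ω : V → ℝ) (α : X.Index)
    (u u' : V) : Prop :=
  upperFract (ω u) < upperFract (ω u') ∨
    (upperFract (ω u) = upperFract (ω u') ∧ X.lt α u u')

open Classical in
/-- The ordered complex `Y(X, ω, [M₁, M₂])` in `V × ℝ`, for `V = ℝ^p` and `V × ℝ = ℝ^(p+1)`.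
It has one simplex for each `γ = (α, v, ℓ)` with `v` a vertex of `X_α` and `M₁ ≤ ℓ < M₂`.  If the
vertices of `X_α` are `v₀, …, v_p` in increasing `≺_α^A`-order and `v = v_j`, then the vertices of
`Y_γ` are `v_i × (A(v_i) - ω(v_i) + ℓ)` for `i ≤ j`, and
`v_i × (A(v_i) - ω(v_i) + ℓ - 1)` for `i ≥ j`. -/
noncomputable def OrderedComplex.raise {p : ℕ} (X : OrderedComplex (Fin p → ℝ))
    (ω : (Fin p → ℝ) →ₗ[ℝ] ℝ) (M₁ M₂ : ℤ) : OrderedComplex (Fin (p + 1) → ℝ) where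
  Index := Σ α : X.Index, {v // v ∈ X.vt α} × {ℓ : ℤ // M₁ ≤ ℓ ∧ ℓ < M₂}
  vt := fun ⟨α, v, ℓ⟩ =>
    ((X.vt α).filter (fun u => u = v.1 ∨ X.ltA ω α u v.1)).image
        (fun u => Fin.snoc (α := fun _ => ℝ) u (upperFract (ω u) - ω u + (ℓ.1 : ℝ))) ∪
      ((X.vt α).filter (fun u => u = v.1 ∨ X.ltA ω α v.1 u)).image
        (fun u => Fin.snoc (α := fun _ => ℝ) u (upperFract (ω u) - ω u + (ℓ.1 : ℝ) - 1))
  lt := fun γ ρ ρ' =>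
    X.lt γ.1 (fun i => ρ i.castSucc) (fun i => ρ' i.castSucc) ∨
      ((∀ i : Fin p, ρ i.castSucc = ρ' i.castSucc) ∧ ρ' (Fin.last p) < ρ (Fin.last p))

/-- The trivial `0`-complex: the single vertex `0` of `ℝ^0`, with the empty order. -/
def trivialComplex : OrderedComplex (Fin 0 → ℝ) where
  Index := Unit
  vt := fun _ => {0}
  lt := fun _ _ _ => False

/-- The complexes `X_0, X_1, …, X_r`: start from the trivial complex and raise the dimension `r`
times with `ω = 0` and the interval `[0, 1]`. -/
noncomputable def cubeComplex : (r : ℕ) → OrderedComplex (Fin r → ℝ)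
  | 0 => trivialComplex
  | r + 1 => (cubeComplex r).raise 0 0 1

/-- The linear form `x ↦ (N / 2π) ∑_{ℓ = 1}^r x[ℓ] θ_ℓ` on `ℝ^(r+j)`. -/
noncomputable def argForm (r j N : ℕ) (θ : Fin r → ℝ) : (Fin (r + j) → ℝ) →ₗ[ℝ] ℝ :=
  ((N : ℝ) / (2 * Real.pi)) • ∑ ℓ : Fin r, θ ℓ • LinearMap.proj (Fin.castAdd j ℓ)

/-- The complexes `X_r, X_{r+1}, …, X_{r+r₂}`: the `j`-th step beyond `X_r` uses the linear form
built from the numbers `θ j ℓ` and the interval `[0, N j]`. -/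
noncomputable def towerComplex (r r₂ : ℕ) (N : Fin r₂ → ℕ) (θ : Fin r₂ → Fin r → ℝ) :
    (j : ℕ) → j ≤ r₂ → OrderedComplex (Fin (r + j) → ℝ)
  | 0, _ => cubeComplex r
  | j + 1, h => (towerComplex r r₂ N θ j (Nat.le_of_succ_le h)).raise
      (argForm r j (N ⟨j, h⟩) (θ ⟨j, h⟩)) 0 (N ⟨j, h⟩ : ℤ)

/-- The principal arguments, in `(-π, π]`, of units at complex embeddings. -/
noncomputable def unitArg {K : Type*} [Field K] [NumberField K] {r r₂ : ℕ}
    (τ : Fin r₂ → K →+* ℂ) (ε : Fin r → (NumberField.RingOfIntegers K)ˣ)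
    (j : Fin r₂) (ℓ : Fin r) : ℝ :=
  Complex.arg (τ j ((ε ℓ : NumberField.RingOfIntegers K) : K))

/-- The complex `𝔛` in `ℝ^(r+r₂)` attached to the units `ε`, the complex embeddings `τ` and the
integers `N`. -/
noncomputable def bigComplex {K : Type*} [Field K] [NumberField K] {r r₂ : ℕ}
    (τ : Fin r₂ → K →+* ℂ) (ε : Fin r → (NumberField.RingOfIntegers K)ˣ) (N : Fin r₂ → ℕ) :
    OrderedComplex (Fin (r + r₂) → ℝ) :=
  towerComplex r r₂ N (unitArg τ ε) r₂ le_rfl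

/-- The lattice `ℤ^r × N_1 ℤ × ⋯ × N_{r₂} ℤ` in `ℝ^(r+r₂)`. -/
def boxLattice (r : ℕ) {r₂ : ℕ} (N : Fin r₂ → ℕ) : AddSubgroup (Fin (r + r₂) → ℝ) :=
  AddSubgroup.pi Set.univ fun i =>
    AddSubgroup.zmultiples (Fin.append (fun _ : Fin r => (1 : ℝ)) (fun j => (N j : ℝ)) i)

/-- `Ω_j(κ) = κ[r+j] + (N_j / 2π) ∑_{ℓ = 1}^r κ[ℓ] arg(ε_ℓ^{(r₁+j)})`. -/
noncomputable def twistedArg {K : Type*} [Field K] [NumberField K] {r r₂ : ℕ}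
    (τ : Fin r₂ → K →+* ℂ) (ε : Fin r → (NumberField.RingOfIntegers K)ˣ) (N : Fin r₂ → ℕ)
    (j : Fin r₂) (κ : Fin (r + r₂) → ℝ) : ℝ :=
  κ (Fin.natAdd r j) +
    ((N j : ℝ) / (2 * Real.pi)) * ∑ ℓ : Fin r, κ (Fin.castAdd r₂ ℓ) * unitArg τ ε j ℓ

/-! The proof is an induction on dimension, with `OrderedComplex.IsTorusComplex` as the invariant.
Its core is `coords`: barycentric expansions of two points differing by a lattice vector are
translates of each other. With `rigid` (no lattice translation carries one simplex to another or
moves a simplex onto itself, except zero) and `cover`, this yields every geometric condition on a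
`Λ`-complex; see `IsTorusComplex.isLambdaComplex`.

The invariant survives raising the dimension (`IsTorusComplex.raise`). Over a simplex of `X` the new
simplices triangulate a prism in staircase fashion. Measured by the linear form `level ω`, which is
`ω(u) + t` at `u × t`, the vertices over `u` lie at heights `A(u)` plus integers, and two vertices
of one simplex differ by at most one, with ties controlled by `≺` (`atMostOneAbove`). Expansions of
congruent points have, up to translation, the same marginal on the base by induction and the same
mean level by linearity. `Finsupp.eq_of_marginal_eq_of_atMostOneAbove` shows that these data
determine the weights. Covering comes from filling the prism vertex by vertex in `≺^A`-order.

Integrality, the count (a factor `(p + 1)(M₂ - M₁)` per raising) and the bound on `Ω_j` follow by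
the same recursion; `Ω_j` is the level at stage `r + j`, whose values on the vertices of a simplex
lie in a unit interval. -/

/-- `c` is the finitely supported function of barycentric coordinates of a convex combination `x`
of the points of `S`. -/
structure IsBarycentric {V : Type} [AddCommGroup V] [Module ℝ V] (S : Finset V) (x : V)
    (c : V →₀ ℝ) : Prop where
  nonneg : ∀ v, 0 ≤ c v
  support_subset : c.support ⊆ S
  total : Finsupp.linearCombination ℝ (fun _ : V => (1 : ℝ)) c = 1
  centroid : Finsupp.linearCombination ℝ (id : V → V) c = x

theorem linearCombination_eq_sum_of_support_subset {V : Type} {S : Finset V} {c : V →₀ ℝ} {W : Type*} [AddCommGroup W] [Module ℝ W]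
    (f : V → W) (h : c.support ⊆ S) :
    Finsupp.linearCombination ℝ f c = ∑ u ∈ S, c u • f u := by
  rw [Finsupp.linearCombination_apply]
  exact Finsupp.sum_of_support_subset _ h _ (by simp)

/-! ### Barycentric expansions as finitely supported functions. -/

section Barycentric

variable {V : Type} [AddCommGroup V] [Module ℝ V] {S : Finset V} {x : V} {c : V →₀ ℝ}

theorem IsBarycentric.mono {T : Finset V} (h : IsBarycentric S x c) (hT : c.support ⊆ T) :
    IsBarycentric T x c :=
  ⟨h.nonneg, hT, h.total, h.centroid⟩

theorem IsBarycentric.sum_eq_one (h : IsBarycentric S x c) : ∑ u ∈ S, c u = 1 := by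
  rw [← h.total, linearCombination_eq_sum_of_support_subset _ h.support_subset]; simp

theorem IsBarycentric.sum_smul_eq (h : IsBarycentric S x c) : ∑ u ∈ S, c u • u = x := by
  rw [← h.centroid, linearCombination_eq_sum_of_support_subset _ h.support_subset]; simp

open Classical in
theorem isBarycentric_indicator {t : V → ℝ} (h0 : ∀ u ∈ S, 0 ≤ t u) (h1 : ∑ u ∈ S, t u = 1)
    (hx : ∑ u ∈ S, t u • u = x) :
    IsBarycentric S x (Finsupp.indicator S fun u _ => t u) := by
  have hs : (Finsupp.indicator S fun u _ => t u).support ⊆ S := Finsupp.support_indicator_subset ..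
  refine ⟨fun v => ?_, hs, ?_, ?_⟩
  · rw [Finsupp.indicator_apply]
    split_ifs with h
    exacts [h0 v h, le_rfl]
  · rw [linearCombination_eq_sum_of_support_subset _ hs]
    refine Eq.trans (Finset.sum_congr rfl fun u hu => ?_) h1
    simp [Finsupp.indicator_apply, hu]
  · rw [linearCombination_eq_sum_of_support_subset _ hs, ← hx]
    exact Finset.sum_congr rfl fun u hu => by simp [Finsupp.indicator_apply, hu]

theorem mem_convexHull_iff_exists_isBarycentric :
    x ∈ convexHull ℝ (S : Set V) ↔ ∃ c, IsBarycentric S x c := by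
  rw [Finset.mem_convexHull']
  constructor
  · rintro ⟨t, h0, h1, hx⟩
    exact ⟨_, isBarycentric_indicator h0 h1 hx⟩
  · rintro ⟨c, hc⟩
    exact ⟨c, fun u _ => hc.nonneg u, hc.sum_eq_one, hc.sum_smul_eq⟩

theorem IsBarycentric.mapDomain {W : Type} [AddCommGroup W] [Module ℝ W] {T : Finset W}
    (h : IsBarycentric S x c) (f : V →ₗ[ℝ] W) (a : W) (hT : ∀ v ∈ S, f v + a ∈ T) :
    IsBarycentric T (f x + a) (c.mapDomain fun v => f v + a) := by
  classical
  refine ⟨fun w => ?_, fun w hw => ?_, ?_, ?_⟩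
  · rw [Finsupp.mapDomain, Finsupp.sum_apply]
    refine Finset.sum_nonneg fun v _ => ?_
    dsimp only
    rw [Finsupp.single_apply]
    split_ifs
    exacts [h.nonneg v, le_rfl]
  · obtain ⟨v, hv, rfl⟩ := Finset.mem_image.mp (Finsupp.mapDomain_support hw)
    exact hT v (h.support_subset hv)
  · rw [Finsupp.linearCombination_mapDomain]
    exact h.total
  · rw [Finsupp.linearCombination_mapDomain,
      linearCombination_eq_sum_of_support_subset _ h.support_subset]
    simp only [Function.comp_apply, id_eq, smul_add, Finset.sum_add_distrib, ← Finset.sum_smul,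
      h.sum_eq_one, one_smul]
    rw [← h.sum_smul_eq, map_sum]
    simp

end Barycentric

/-! ### From uniqueness of coordinates modulo the lattice to `Λ`-complexes. -/

/-- The combinatorial content of being a `Λ`-complex, phrased through barycentric coordinates. -/
structure OrderedComplex.IsTorusComplex {p : ℕ} (X : OrderedComplex (Fin p → ℝ))
    (Λ : AddSubgroup (Fin p → ℝ)) : Prop where
  card_vt : ∀ α, (X.vt α).card = p + 1
  irrefl : ∀ α, ∀ u ∈ X.vt α, ¬ X.lt α u u
  trans : ∀ α, ∀ u ∈ X.vt α, ∀ v ∈ X.vt α, ∀ w ∈ X.vt α,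
    X.lt α u v → X.lt α v w → X.lt α u w
  total : ∀ α, ∀ u ∈ X.vt α, ∀ v ∈ X.vt α, X.lt α u v ∨ u = v ∨ X.lt α v u
  invariant : ∀ α β, ∀ v ∈ X.vt α, ∀ w ∈ X.vt α, ∀ l ∈ Λ, v + l ∈ X.vt β → w + l ∈ X.vt β →
    (X.lt α v w ↔ X.lt β (v + l) (w + l))
  coords : ∀ α β x c c', ∀ l ∈ Λ, IsBarycentric (X.vt α) x c →
    IsBarycentric (X.vt β) (x + l) c' → c' = c.mapDomain fun v => v + l
  rigid : ∀ α β, ∀ l ∈ Λ, (∀ v ∈ X.vt α, v + l ∈ X.vt β) → α = β ∧ l = 0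
  cover : ∀ x, ∃ l ∈ Λ, ∃ α, x + l ∈ X.simplex α

namespace OrderedComplex.IsTorusComplex

variable {p : ℕ} {X : OrderedComplex (Fin p → ℝ)} {Λ : AddSubgroup (Fin p → ℝ)}

theorem coords_eq (h : X.IsTorusComplex Λ) {α β : X.Index} {x : Fin p → ℝ}
    {c c' : (Fin p → ℝ) →₀ ℝ} (hc : IsBarycentric (X.vt α) x c)
    (hc' : IsBarycentric (X.vt β) x c') : c' = c := by
  rw [h.coords α β x c c' 0 Λ.zero_mem hc (by simpa using hc')]
  simp [← Function.id_def]

/-- An affine dependence would give a Radon point, which has two expansions with disjoint supports,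
against uniqueness of coordinates. -/
theorem affineIndependent (h : X.IsTorusComplex Λ) (α : X.Index) :
    AffineIndependent ℝ (fun v : {v // v ∈ X.vt α} => (v : Fin p → ℝ)) := by
  classical
  by_contra hα
  obtain ⟨I, x, hx, hx'⟩ := Convex.radon_partition hα
  have key : ∀ J : Set {v // v ∈ X.vt α}, x ∈ convexHull ℝ (Subtype.val '' J) →
      ∃ c, IsBarycentric (X.vt α) x c ∧ ∀ v ∈ c.support, v ∈ Subtype.val '' J := by
    intro J hJ
    have hJf : (Subtype.val '' J).Finite := (X.vt α).finite_toSet.subset (by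
      rintro _ ⟨v, _, rfl⟩; exact v.2)
    rw [← hJf.coe_toFinset, mem_convexHull_iff_exists_isBarycentric] at hJ
    obtain ⟨c, hc⟩ := hJ
    have hs : ∀ v ∈ c.support, v ∈ Subtype.val '' J := fun v hv =>
      hJf.mem_toFinset.mp (hc.support_subset hv)
    refine ⟨c, hc.mono fun v hv => ?_, hs⟩
    obtain ⟨u, _, rfl⟩ := hs v hv
    exact u.2
  obtain ⟨c, hc, hI⟩ := key I hx
  obtain ⟨c', hc', hI'⟩ := key Iᶜ hx'
  have he := h.coords_eq hc hc'
  subst he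
  have h0 : c'.support = ∅ := by
    refine Finset.eq_empty_of_forall_notMem fun v hv => ?_
    obtain ⟨u, hu, rfl⟩ := hI v hv
    obtain ⟨u', hu', h⟩ := hI' _ hv
    exact hu' (Subtype.ext h ▸ hu)
  rw [Finsupp.support_eq_empty] at h0
  simpa [h0] using hc.total

theorem spanningVertices_eq (h : X.IsTorusComplex Λ) {α : X.Index} {x : Fin p → ℝ}
    {c : (Fin p → ℝ) →₀ ℝ} (hc : IsBarycentric (X.vt α) x c) :
    spanningVertices (X.vt α) x = c.support := by
  classical
  ext v
  constructor
  · rintro ⟨hv, t, h0, h1, hx, hpos⟩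
    rw [← h.coords_eq hc (isBarycentric_indicator h0 h1 hx)]
    simp [Finsupp.indicator_apply, hv, hpos.ne']
  · intro hv
    exact ⟨hc.support_subset hv, c, fun u _ => hc.nonneg u, hc.sum_eq_one, hc.sum_smul_eq,
      (hc.nonneg v).lt_of_ne' (Finsupp.mem_support_iff.mp hv)⟩

theorem support_eq_of_mem_interior (h : X.IsTorusComplex Λ) {α : X.Index} {x : Fin p → ℝ}
    {c : (Fin p → ℝ) →₀ ℝ} (hc : IsBarycentric (X.vt α) x c) (hx : x ∈ interior (X.simplex α)) :
    c.support = X.vt α := by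
  classical
  refine hc.support_subset.antisymm fun v hv => ?_
  -- Push `x` slightly away from `v` inside the simplex. Then `x` is a convex combination of the
  -- pushed point and `v` with positive weight on `v`, and coordinates are unique.
  have hcont : Filter.Tendsto (fun e : ℝ => x + e • (x - v)) (nhdsWithin 0 (Set.Ioi 0))
      (nhds x) := by
    have : Continuous (fun e : ℝ => x + e • (x - v)) := by fun_prop
    simpa using (this.tendsto 0).mono_left nhdsWithin_le_nhds
  obtain ⟨e, he, hpos⟩ := ((hcont.eventually (mem_interior_iff_mem_nhds.mp hx)).and
    self_mem_nhdsWithin).exists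
  have hpos : 0 < e := hpos
  obtain ⟨d, hd⟩ := mem_convexHull_iff_exists_isBarycentric.mp he
  have hb : IsBarycentric (X.vt α) x ((1 + e)⁻¹ • (d + Finsupp.single v e)) := by
    refine ⟨fun u => ?_, ?_, ?_, ?_⟩
    · have := hd.nonneg u
      have : 0 ≤ Finsupp.single v e u := by
        rw [Finsupp.single_apply]; split_ifs <;> linarith
      simp only [Finsupp.smul_apply, Finsupp.add_apply, smul_eq_mul]
      positivity
    · refine Finsupp.support_smul.trans (Finsupp.support_add.trans
        (Finset.union_subset hd.support_subset (Finsupp.support_single_subset.trans ?_)))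
      simpa using hv
    · rw [map_smul, map_add, hd.total, Finsupp.linearCombination_single]
      simp only [smul_eq_mul, mul_one]
      field_simp
    · rw [map_smul, map_add, hd.centroid, Finsupp.linearCombination_single, id, smul_sub,
        inv_smul_eq_iff₀ (by positivity), add_smul]
      module
  rw [← h.coords_eq hc hb, Finsupp.mem_support_iff]
  have := hd.nonneg v
  simp only [Finsupp.smul_apply, Finsupp.add_apply, Finsupp.single_eq_same, smul_eq_mul]
  positivity

theorem support_add (c : (Fin p → ℝ) →₀ ℝ) (l : Fin p → ℝ) :
    ((c.mapDomain fun v => v + l).support : Set (Fin p → ℝ)) = (fun v => v + l) '' c.support := by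
  classical
  rw [Finsupp.mapDomain_support_of_injective (add_left_injective l)]
  simp

/-- The barycentre of a simplex has full support, so its unique expansion recovers all the vertices;
`rigid` then identifies the indices. -/
theorem simplex_injective (h : X.IsTorusComplex Λ) : Function.Injective X.simplex := by
  intro α β hαβ
  refine (h.rigid α β 0 Λ.zero_mem fun v hv => ?_).1
  have hcard := h.card_vt α
  have hpos : (0 : ℝ) < (X.vt α).card := by rw [hcard]; positivity
  have hc : IsBarycentric (X.vt α) _ (Finsupp.indicator (X.vt α) fun _ _ => ((X.vt α).card : ℝ)⁻¹) :=
    isBarycentric_indicator (t := fun _ => ((X.vt α).card : ℝ)⁻¹)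
      (fun u _ => by positivity) (by simp [hpos.ne']) rfl
  have hx := mem_convexHull_iff_exists_isBarycentric.mpr ⟨_, hc⟩
  change _ ∈ X.simplex α at hx
  rw [hαβ] at hx
  obtain ⟨c', hc'⟩ := mem_convexHull_iff_exists_isBarycentric.mp hx
  have := hc'.support_subset
  rw [h.coords_eq hc hc'] at this
  rw [add_zero]
  refine this ?_
  simp [Finsupp.indicator_apply, hv, hpos.ne', Finsupp.mem_support_iff]

theorem isLambdaComplex (h : X.IsTorusComplex Λ) (hd : DiscreteTopology Λ)
    (hs : Submodule.span ℝ (Λ : Set (Fin p → ℝ)) = ⊤) : X.IsLambdaComplex Λ where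
  discrete := hd
  span_eq_top := hs
  isOrdered := ⟨h.affineIndependent, fun α => by rw [h.card_vt, Module.finrank_fin_fun],
    h.irrefl, h.trans, h.total⟩
  simplicial := by
    classical
    intro α β
    apply subset_antisymm
    · rintro x ⟨hx, hx'⟩
      obtain ⟨c, hc⟩ := mem_convexHull_iff_exists_isBarycentric.mp hx
      obtain ⟨c', hc'⟩ := mem_convexHull_iff_exists_isBarycentric.mp hx'
      rw [h.coords_eq hc hc'] at hc'
      rw [← Finset.coe_inter, mem_convexHull_iff_exists_isBarycentric]
      exact ⟨c, hc.mono (Finset.subset_inter hc.support_subset hc'.support_subset)⟩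
    · exact Set.subset_inter (convexHull_mono Set.inter_subset_left)
        (convexHull_mono Set.inter_subset_right)
  compatible := fun α β v w hv hv' hw hw' => by
    simpa using h.invariant α β v hv w hw 0 Λ.zero_mem (by simpa) (by simpa)
  invariant := h.invariant
  surjOn := by
    rintro q -
    obtain ⟨x, rfl⟩ := QuotientAddGroup.mk_surjective q
    obtain ⟨l, hl, α, hα⟩ := h.cover x
    refine ⟨x + l, Set.mem_iUnion.mpr ⟨α, hα⟩, ?_⟩
    rw [QuotientAddGroup.mk_add_of_mem _ hl]
  injOn := by
    intro x hx y hy hxy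
    obtain ⟨α, hα⟩ := Set.mem_iUnion.mp hx
    obtain ⟨β, hβ⟩ := Set.mem_iUnion.mp hy
    have hl : -x + y ∈ Λ := QuotientAddGroup.eq.mp hxy
    obtain ⟨c, hc⟩ := mem_convexHull_iff_exists_isBarycentric.mp (interior_subset hα)
    obtain ⟨c', hc'⟩ := mem_convexHull_iff_exists_isBarycentric.mp (interior_subset hβ)
    -- Interior points have full support, so translated coordinates mean translated vertex sets, and
    -- `rigid` forces the translation to be zero.
    have he := h.coords α β x c c' _ hl hc (by simpa using hc')
    have hs := support_add c (-x + y)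
    rw [← he, h.support_eq_of_mem_interior hc hα, h.support_eq_of_mem_interior hc' hβ] at hs
    have := (h.rigid α β _ hl fun v hv => by
      have : v + (-x + y) ∈ (X.vt β : Set _) := hs ▸ Set.mem_image_of_mem _ hv
      exact this).2
    exact (neg_add_eq_zero.mp this)
  equivariant := by
    intro α β x hx l hl hxl
    obtain ⟨c, hc⟩ := mem_convexHull_iff_exists_isBarycentric.mp hx
    obtain ⟨c', hc'⟩ := mem_convexHull_iff_exists_isBarycentric.mp hxl
    rw [h.spanningVertices_eq hc, h.spanningVertices_eq hc', h.coords α β x c c' l hl hc hc',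
      support_add]

end OrderedComplex.IsTorusComplex

/-! ### Weights determined by their marginals and mean level. -/

section Tight

variable {E V : Type}

/-- Two weights with the same marginals and the same mean of `L` agree when, in every fibre, the
support of the first lies below the support of the second. -/
theorem Finsupp.eq_of_marginal_eq_of_le {f : E → V} {L : E → ℝ} {c c' : E →₀ ℝ}
    (hinj : ∀ x ∈ c.support, ∀ y ∈ c'.support, f x = f y → L x = L y → x = y)
    (hinj₁ : ∀ x ∈ c.support, ∀ y ∈ c.support, f x = f y → L x = L y → x = y)
    (hinj₂ : ∀ x ∈ c'.support, ∀ y ∈ c'.support, f x = f y → L x = L y → x = y)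
    (h0 : ∀ x, 0 ≤ c x) (h0' : ∀ x, 0 ≤ c' x) (hf : c.mapDomain f = c'.mapDomain f)
    (hL : Finsupp.linearCombination ℝ L c = Finsupp.linearCombination ℝ L c')
    (hle : ∀ x ∈ c.support, ∀ y ∈ c'.support, f x = f y → L x ≤ L y) : c = c' := by
  classical
  -- A threshold in each fibre separates the two supports. Equal marginals give `k ∘ f` the same
  -- mean under both weights, so the nonnegative gaps to the threshold sum to zero and both supports
  -- lie on it.
  have hk : ∀ v, ∃ k : ℝ, (∀ x ∈ c.support, f x = v → L x ≤ k) ∧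
      ∀ y ∈ c'.support, f y = v → k ≤ L y := by
    intro v
    by_cases hv : (c'.support.filter fun y => f y = v).Nonempty
    · obtain ⟨y, hy, hmin⟩ := Finset.exists_min_image _ L hv
      rw [Finset.mem_filter] at hy
      exact ⟨L y, fun x hx hxv => hle x hx y hy.1 (hxv.trans hy.2.symm),
        fun z hz hzv => hmin z (Finset.mem_filter.mpr ⟨hz, hzv⟩)⟩
    · obtain ⟨k, hk⟩ := (c.support.image L).bddAbove
      exact ⟨k, fun x hx _ => hk (Finset.mem_coe.mpr (Finset.mem_image_of_mem _ hx)),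
        fun y hy hyv => (hv ⟨y, Finset.mem_filter.mpr ⟨hy, hyv⟩⟩).elim⟩
  choose k hk hk' using hk
  have hkf : Finsupp.linearCombination ℝ (k ∘ f) c = Finsupp.linearCombination ℝ (k ∘ f) c' := by
    rw [← Finsupp.linearCombination_mapDomain, hf, Finsupp.linearCombination_mapDomain]
  simp only [Finsupp.linearCombination_apply, Finsupp.sum, smul_eq_mul] at hkf hL
  have hn : ∀ x ∈ c.support, 0 ≤ c x * (k (f x) - L x) := fun x hx =>
    mul_nonneg (h0 x) (sub_nonneg.mpr (hk _ x hx rfl))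
  have hn' : ∀ x ∈ c'.support, 0 ≤ c' x * (L x - k (f x)) := fun x hx =>
    mul_nonneg (h0' x) (sub_nonneg.mpr (hk' _ x hx rfl))
  have hs : ∑ x ∈ c.support, c x * (k (f x) - L x) +
      ∑ x ∈ c'.support, c' x * (L x - k (f x)) = 0 := by
    simp only [mul_sub, Finset.sum_sub_distrib]
    simp only [Function.comp_apply] at hkf
    linarith
  have hz := (Finset.sum_eq_zero_iff_of_nonneg hn).mp
    (by linarith [Finset.sum_nonneg hn, Finset.sum_nonneg hn'])
  have hz' := (Finset.sum_eq_zero_iff_of_nonneg hn').mp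
    (by linarith [Finset.sum_nonneg hn, Finset.sum_nonneg hn'])
  have e : ∀ x ∈ c.support, L x = k (f x) := fun x hx => by
    have := (mul_eq_zero.mp (hz x hx)).resolve_left (Finsupp.mem_support_iff.mp hx)
    linarith
  have e' : ∀ x ∈ c'.support, L x = k (f x) := fun x hx => by
    have := (mul_eq_zero.mp (hz' x hx)).resolve_left (Finsupp.mem_support_iff.mp hx)
    linarith
  refine Finsupp.mapDomain_injOn (c.support ∪ c'.support : Set E) ?_ (by simp) (by simp) hf
  rintro x (hx | hx) y (hy | hy) hxy
  · exact hinj₁ x hx y hy hxy (by rw [e x hx, e y hy, hxy])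
  · exact hinj x hx y hy hxy (by rw [e x hx, e' y hy, hxy])
  · exact (hinj y hy x hx hxy.symm (by rw [e' x hx, e y hy, hxy])).symm
  · exact hinj₂ x hx y hy hxy (by rw [e' x hx, e' y hy, hxy])

/-- `x` is at most the translate by one of `y`, in the order by the value of `L`, where ties are
broken by the relation `lt` between the images under `f`. -/
def AtMostOneAbove (f : E → V) (L : E → ℝ) (lt : V → V → Prop) (x y : E) : Prop :=
  L x < L y + 1 ∨ (L x = L y + 1 ∧ (f x = f y ∨ lt (f x) (f y)))

theorem AtMostOneAbove.le {f : E → V} {L : E → ℝ} {lt : V → V → Prop} {x y : E}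
    (h : AtMostOneAbove f L lt x y) : L x ≤ L y + 1 := by
  rcases h with h | h
  exacts [h.le, h.1.le]

theorem AtMostOneAbove.of_eq {f : E → V} {L : E → ℝ} {lt : V → V → Prop} {x y : E}
    (h : AtMostOneAbove f L lt x y) (he : L x = L y + 1) : f x = f y ∨ lt (f x) (f y) := by
  rcases h with h | h
  exacts [absurd he h.ne, h.2]

/-- Weights whose supports have no two elements more than one apart are determined by their
marginals and the mean of `L`. -/
theorem Finsupp.eq_of_marginal_eq_of_atMostOneAbove {f : E → V} {L : E → ℝ} {lt : V → V → Prop}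
    {c c' : E →₀ ℝ} {D : Set E} (hD : ∀ x ∈ c.support, x ∈ D) (hD' : ∀ x ∈ c'.support, x ∈ D)
    (asymm : ∀ x ∈ D, ∀ y ∈ D, lt (f x) (f y) → ¬ lt (f y) (f x))
    (hinj : ∀ x ∈ D, ∀ y ∈ D, f x = f y → L x = L y → x = y)
    (hint : ∀ x ∈ D, ∀ y ∈ D, f x = f y → L x < L y → L x + 1 ≤ L y)
    (h0 : ∀ x, 0 ≤ c x) (h0' : ∀ x, 0 ≤ c' x)
    (ht : ∀ x ∈ c.support, ∀ y ∈ c.support, AtMostOneAbove f L lt x y)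
    (ht' : ∀ x ∈ c'.support, ∀ y ∈ c'.support, AtMostOneAbove f L lt x y)
    (hf : c.mapDomain f = c'.mapDomain f)
    (hL : Finsupp.linearCombination ℝ L c = Finsupp.linearCombination ℝ L c') : c = c' := by
  classical
  by_cases hle : ∀ x ∈ c.support, ∀ y ∈ c'.support, f x = f y → L x ≤ L y
  · exact Finsupp.eq_of_marginal_eq_of_le (fun x hx y hy => hinj x (hD x hx) y (hD' y hy))
      (fun x hx y hy => hinj x (hD x hx) y (hD y hy))
      (fun x hx y hy => hinj x (hD' x hx) y (hD' y hy)) h0 h0' hf hL hle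
  by_cases hge : ∀ x ∈ c'.support, ∀ y ∈ c.support, f x = f y → L x ≤ L y
  · exact (Finsupp.eq_of_marginal_eq_of_le (fun x hx y hy => hinj x (hD' x hx) y (hD y hy))
      (fun x hx y hy => hinj x (hD' x hx) y (hD' y hy))
      (fun x hx y hy => hinj x (hD x hx) y (hD y hy)) h0' h0 hf.symm hL.symm hge).symm
  push Not at hle hge
  obtain ⟨top, htop, bot', hbot', hfv, hlt⟩ := hle
  obtain ⟨top', htop', bot, hbot, hfw, hlt'⟩ := hge
  -- Two fibres cross in opposite directions. The spacing and one-apart inequalities form a cycle,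
  -- so all are equalities; the tie-breaks then give `lt` both ways unless the two fibres coincide.
  have l1 := hint bot' (hD' _ hbot') top (hD _ htop) hfv.symm hlt
  have l2 := hint bot (hD _ hbot) top' (hD' _ htop') hfw.symm hlt'
  have t1 := (ht top htop bot hbot).le
  have t2 := (ht' top' htop' bot' hbot').le
  have a1 := (ht top htop bot hbot).of_eq (by linarith)
  have a2 := (ht' top' htop' bot' hbot').of_eq (by linarith)
  rw [hfw, ← hfv] at a2
  have hvw : f top = f bot := by
    rcases a1 with a1 | a1
    · exact a1
    rcases a2 with a2 | a2
    · exact a2.symm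
    exact absurd a2 (asymm _ (hD _ htop) _ (hD _ hbot) a1)
  obtain rfl : top = top' := hinj _ (hD _ htop) _ (hD' _ htop') (hvw.trans hfw.symm) (by linarith)
  obtain rfl : bot = bot' := hinj _ (hD _ hbot) _ (hD' _ hbot') (hvw.symm.trans hfv) (by linarith)
  have hone : L top = L bot + 1 := by linarith
  clear a1 a2 t1 t2 l1 l2 hfv hfw hlt hlt'
  have hU : ∀ x, x ∈ c.support ∨ x ∈ c'.support →
      x ∈ D ∧ AtMostOneAbove f L lt x bot ∧ AtMostOneAbove f L lt top x := by
    rintro x (hx | hx)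
    · exact ⟨hD x hx, ht x hx bot hbot, ht top htop x hx⟩
    · exact ⟨hD' x hx, ht' x hx bot hbot', ht' top htop' x hx⟩
  have hfib : ∀ x, x ∈ c.support ∨ x ∈ c'.support → f x = f top → x = top ∨ x = bot := by
    intro x hx hxt
    obtain ⟨hxD, h1, h2⟩ := hU x hx
    rcases lt_or_ge (L x) (L top) with hl | hl
    · have := hint _ hxD _ (hD _ htop) hxt hl
      exact .inr (hinj _ hxD _ (hD _ hbot) (hxt.trans hvw) (by linarith [h2.le]))
    · exact .inl (hinj _ hxD _ (hD _ htop) hxt (by linarith [h1.le]))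
  -- Two points in another fibre would sit at the levels of `bot` and `top`, and the tie-breaks
  -- would put that fibre both before and after `f top`.
  have hsingle : ∀ x y, x ∈ c.support ∨ x ∈ c'.support → y ∈ c.support ∨ y ∈ c'.support →
      f x ≠ f top → f x = f y → ¬ L x < L y := by
    intro x y hx hy hxt hxy hl
    obtain ⟨hxD, h1, h2⟩ := hU x hx
    obtain ⟨hyD, h3, h4⟩ := hU y hy
    have := hint _ hxD _ hyD hxy hl
    have h5 := h3.of_eq (by linarith [h2.le, h3.le])
    have h6 := h2.of_eq (by linarith [h2.le, h3.le])
    rw [← hxy, ← hvw] at h5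
    exact asymm _ hxD _ (hD _ htop) (h5.resolve_left hxt) (h6.resolve_left (Ne.symm hxt))
  set d := c - c' with hd
  have hds : ∀ x ∈ d.support, x ∈ c.support ∨ x ∈ c'.support := fun x hx =>
    Finset.mem_union.mp (Finsupp.support_sub hx)
  have hdf : d.mapDomain f = 0 := by
    have : Finsupp.mapDomain.addMonoidHom (M := ℝ) f d = 0 := by
      rw [hd, map_sub, sub_eq_zero]; exact hf
    exact this
  have hdL : Finsupp.linearCombination ℝ L d = 0 := by rw [hd, map_sub, hL, sub_self]
  have htb : top ≠ bot := fun h => by rw [h] at hone; linarith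
  -- Outside the fibre of `top` the map `f` is injective, so the zero marginal kills `e`. On that
  -- fibre the masses at `top` and `bot` cancel, and the mean of `L` is `d top * (L top - L bot) = d
  -- top`.
  set e := d.filter fun x => f x ≠ f top with he
  have hde : d = e + (Finsupp.single top (d top) + Finsupp.single bot (d bot)) := by
    ext x
    rw [Finsupp.add_apply, Finsupp.add_apply, he, Finsupp.filter_apply]
    by_cases hx : f x = f top
    · rw [if_neg (by simpa using hx), zero_add]
      by_cases hx0 : d x = 0
      · rw [hx0, Finsupp.single_apply, Finsupp.single_apply]
        split_ifs with h1 h2 h2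
        · exact absurd (h1.trans h2.symm) htb
        · rw [h1, hx0, add_zero]
        · rw [h2, hx0, add_zero]
        · rw [add_zero]
      · rcases hfib x (hds x (Finsupp.mem_support_iff.mpr hx0)) hx with rfl | rfl
        · simp [htb.symm]
        · simp [htb]
    · rw [if_pos hx]
      have h1 : top ≠ x := fun h => hx (by rw [h])
      have h2 : bot ≠ x := fun h => hx (by rw [← h, hvw])
      simp [h1, h2]
  have hes : ∀ x ∈ e.support, (x ∈ c.support ∨ x ∈ c'.support) ∧ f x ≠ f top := by
    intro x hx
    rw [he, Finsupp.support_filter, Finset.mem_filter] at hx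
    exact ⟨hds x hx.1, hx.2⟩
  have hmap : e.mapDomain f + Finsupp.single (f top) (d top + d bot) = 0 := by
    rw [hde, Finsupp.mapDomain_add, Finsupp.mapDomain_add, Finsupp.mapDomain_single,
      Finsupp.mapDomain_single, ← hvw, ← Finsupp.single_add] at hdf
    exact hdf
  have hsum : d top + d bot = 0 := by
    have h1 := DFunLike.congr_fun hmap (f top)
    have h2 : e.mapDomain f (f top) = 0 := by
      by_contra h
      obtain ⟨x, hx, hxt⟩ := Finset.mem_image.mp
        (Finsupp.mapDomain_support (Finsupp.mem_support_iff.mpr h))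
      exact (hes x hx).2 hxt
    simpa [h2] using h1
  have he0 : e = 0 := by
    rw [hsum, Finsupp.single_zero, add_zero] at hmap
    refine Finsupp.mapDomain_injOn (e.support : Set E) ?_ (by simp) (by simp)
      (hmap.trans Finsupp.mapDomain_zero.symm)
    intro x hx y hy hxy
    obtain ⟨hx, hxt⟩ := hes x hx
    obtain ⟨hy, hyt⟩ := hes y hy
    exact hinj _ (hU x hx).1 _ (hU y hy).1 hxy (le_antisymm
      (not_lt.mp (hsingle y x hy hx hyt hxy.symm)) (not_lt.mp (hsingle x y hx hy hxt hxy)))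
  have htop0 : d top = 0 := by
    rw [hde, he0, zero_add, map_add, Finsupp.linearCombination_single,
      Finsupp.linearCombination_single, smul_eq_mul, smul_eq_mul] at hdL
    have : d bot = - d top := by linarith
    rw [this, hone] at hdL
    linarith
  have hbot0 : d bot = 0 := by linarith
  have : d = 0 := by rw [hde, he0, htop0, hbot0]; simp
  exact sub_eq_zero.mp this

end Tight

/-! ### Tools for raising: projection, upper fractional part, partial sums. -/

/-- Forgetting the last coordinate. -/
def dropLast {p : ℕ} : (Fin (p + 1) → ℝ) →ₗ[ℝ] (Fin p → ℝ) :=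
  LinearMap.funLeft ℝ ℝ Fin.castSucc

@[simp]
theorem dropLast_snoc {p : ℕ} (u : Fin p → ℝ) (t : ℝ) :
    dropLast (Fin.snoc (α := fun _ => ℝ) u t) = u := by
  ext i; simp [dropLast, LinearMap.funLeft_apply]

theorem ext_dropLast {p : ℕ} {ρ ρ' : Fin (p + 1) → ℝ} (h : dropLast ρ = dropLast ρ')
    (h' : ρ (Fin.last p) = ρ' (Fin.last p)) : ρ = ρ' := by
  ext i
  refine Fin.lastCases h' (fun i => ?_) i
  exact congrFun h i

theorem exists_int_upperFract_sub (x : ℝ) : ∃ m : ℤ, upperFract x - x = m :=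
  ((upperFract_eq_iff x _).mp rfl).1

theorem upperFract_pos (x : ℝ) : 0 < upperFract x := ((upperFract_eq_iff x _).mp rfl).2.1

theorem upperFract_le_one (x : ℝ) : upperFract x ≤ 1 := ((upperFract_eq_iff x _).mp rfl).2.2

theorem Finsupp.apply_mem_support_mapDomain {E V : Type} (f : E → V) {c : E →₀ ℝ}
    (h0 : ∀ x, 0 ≤ c x) {x : E} (hx : x ∈ c.support) : f x ∈ (c.mapDomain f).support := by
  classical
  rw [Finsupp.mem_support_iff, Finsupp.mapDomain, Finsupp.sum_apply, Finsupp.sum]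
  have hs := Finset.single_le_sum (f := fun y => Finsupp.single (f y) (c y) (f x))
    (fun y _ => by
      rw [Finsupp.single_apply]; split_ifs; exacts [h0 y, le_rfl]) hx
  have hpos : 0 < c x := (h0 x).lt_of_ne' (Finsupp.mem_support_iff.mp hx)
  simp only [Finsupp.single_eq_same] at hs
  exact (hpos.trans_le hs).ne'

open Classical in
/-- A number in `[0, 1)` lies in one of the consecutive intervals whose lengths are the given
weights, listed in the given order. -/
theorem exists_eq_sum_filter_add_mul {V : Type} {S : Finset V} {lt : V → V → Prop}
    (irrefl : ∀ u ∈ S, ¬ lt u u)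
    (trans : ∀ u ∈ S, ∀ v ∈ S, ∀ w ∈ S, lt u v → lt v w → lt u w)
    (total : ∀ u ∈ S, ∀ v ∈ S, lt u v ∨ u = v ∨ lt v u)
    {b : V → ℝ} (h1 : ∑ u ∈ S, b u = 1) {f : ℝ} (hf0 : 0 ≤ f)
    (hf1 : f < 1) :
    ∃ v ∈ S, ∃ θ : ℝ, 0 ≤ θ ∧ θ ≤ 1 ∧ f = ∑ u ∈ S.filter (fun u => lt u v), b u + θ * b v := by
  -- Counting predecessors turns the order into natural numbers, so the first partial sum exceeding
  -- `f` can be found by `Nat.find`.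
  set rank : V → ℕ := fun u => (S.filter fun w => lt w u).card with hrank
  have hmono : ∀ u ∈ S, ∀ v ∈ S, lt u v → rank u < rank v := by
    intro u hu v hv huv
    refine Finset.card_lt_card (Finset.ssubset_iff_of_subset ?_ |>.mpr ⟨u, ?_, ?_⟩)
    · intro w hw
      rw [Finset.mem_filter] at hw ⊢
      exact ⟨hw.1, trans w hw.1 u hu v hv hw.2 huv⟩
    · exact Finset.mem_filter.mpr ⟨hu, huv⟩
    · exact fun h => irrefl u hu (Finset.mem_filter.mp h).2
  have hiff : ∀ u ∈ S, ∀ v ∈ S, (rank u < rank v ↔ lt u v) := by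
    refine fun u hu v hv => ⟨fun h => ?_, hmono u hu v hv⟩
    rcases total u hu v hv with h' | rfl | h'
    · exact h'
    · exact (lt_irrefl _ h).elim
    · exact (lt_asymm h (hmono v hv u hu h')).elim
  have hinj : ∀ u ∈ S, ∀ v ∈ S, rank u = rank v → u = v := by
    intro u hu v hv h
    rcases total u hu v hv with h' | h' | h'
    · exact absurd h (hmono u hu v hv h').ne
    · exact h'
    · exact absurd h (hmono v hv u hu h').ne'
  have hex : ∃ k, f < ∑ u ∈ S.filter (fun u => rank u < k), b u := by
    refine ⟨S.card + 1, ?_⟩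
    rw [Finset.filter_true_of_mem, h1]
    · exact hf1
    · exact fun u _ => Nat.lt_succ_of_le (Finset.card_filter_le _ _)
  obtain ⟨k, hk⟩ : ∃ k, Nat.find hex = k + 1 := by
    refine Nat.exists_eq_succ_of_ne_zero fun h => ?_
    have := Nat.find_spec hex
    rw [h] at this
    simp only [not_lt_zero, Finset.filter_false, Finset.sum_empty] at this
    linarith
  have hlow := not_lt.mp (Nat.find_min hex (m := k) (by omega))
  have hupp := Nat.find_spec hex
  rw [hk] at hupp
  obtain ⟨v, hv, hvk⟩ : ∃ v ∈ S, rank v = k := by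
    by_contra hno
    push Not at hno
    refine absurd hupp (not_lt.mpr ?_)
    rw [Finset.filter_congr (q := fun u => rank u < k) fun u hu => ?_]
    · exact hlow
    · have := hno u hu
      omega
  have hins : S.filter (fun u => rank u < k + 1) =
      insert v (S.filter fun u => rank u < k) := by
    ext u
    simp only [Finset.mem_filter, Finset.mem_insert]
    constructor
    · rintro ⟨hu, h⟩
      rcases Nat.lt_succ_iff_lt_or_eq.mp h with h | h
      · exact .inr ⟨hu, h⟩
      · exact .inl (hinj u hu v hv (h.trans hvk.symm))
    · rintro (rfl | ⟨hu, h⟩)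
      · exact ⟨hv, by omega⟩
      · exact ⟨hu, by omega⟩
  rw [hins, Finset.sum_insert (by simp [hvk])] at hupp
  have hfl : S.filter (fun u => rank u < k) = S.filter fun u => lt u v :=
    Finset.filter_congr fun u hu => by rw [← hvk, hiff u hu v hv]
  rw [hfl] at hupp hlow
  -- The partial sum through `v` exceeds `f` and the one before it does not; no sign condition on
  -- `b` is needed.
  have hpos : 0 < b v := by linarith
  refine ⟨v, hv, (f - ∑ u ∈ S.filter (fun u => lt u v), b u) / b v, ?_, ?_, ?_⟩
  · exact div_nonneg (by linarith) hpos.le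
  · rw [div_le_one hpos]; linarith
  · rw [div_mul_cancel₀ _ hpos.ne']; ring

/-! ### Raising the dimension preserves the invariant. -/

namespace OrderedComplex

variable {p : ℕ} {X : OrderedComplex (Fin p → ℝ)} {Λ : AddSubgroup (Fin p → ℝ)}
  {ω : (Fin p → ℝ) →ₗ[ℝ] ℝ} {M₁ M₂ : ℤ}

/-- The linear form by which the vertices of `X.raise ω M₁ M₂` over a simplex are ordered. -/
def level (ω : (Fin p → ℝ) →ₗ[ℝ] ℝ) : (Fin (p + 1) → ℝ) →ₗ[ℝ] ℝ :=
  ω ∘ₗ dropLast + LinearMap.proj (Fin.last p)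

theorem level_apply (ρ : Fin (p + 1) → ℝ) :
    level ω ρ = ω (dropLast ρ) + ρ (Fin.last p) := rfl

theorem mem_raise_vt {α : X.Index} {v : {v // v ∈ X.vt α}} {k : {k : ℤ // M₁ ≤ k ∧ k < M₂}}
    {ρ : Fin (p + 1) → ℝ} :
    ρ ∈ (X.raise ω M₁ M₂).vt ⟨α, v, k⟩ ↔ dropLast ρ ∈ X.vt α ∧
      (((dropLast ρ = v ∨ X.ltA ω α (dropLast ρ) v) ∧
          level ω ρ = upperFract (ω (dropLast ρ)) + k.1) ∨
        ((dropLast ρ = v ∨ X.ltA ω α v (dropLast ρ)) ∧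
          level ω ρ = upperFract (ω (dropLast ρ)) + k.1 - 1)) := by
  simp only [raise, Finset.mem_union, Finset.mem_image, Finset.mem_filter, level_apply]
  constructor
  · rintro (⟨u, ⟨hu, h⟩, rfl⟩ | ⟨u, ⟨hu, h⟩, rfl⟩)
    · simp only [dropLast_snoc, Fin.snoc_last]
      exact ⟨hu, .inl ⟨h, by ring⟩⟩
    · simp only [dropLast_snoc, Fin.snoc_last]
      exact ⟨hu, .inr ⟨h, by ring⟩⟩
  · rintro ⟨hu, ⟨h, he⟩ | ⟨h, he⟩⟩
    · refine .inl ⟨_, ⟨hu, h⟩, ext_dropLast (by simp) ?_⟩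
      rw [Fin.snoc_last]; linarith
    · refine .inr ⟨_, ⟨hu, h⟩, ext_dropLast (by simp) ?_⟩
      rw [Fin.snoc_last]; linarith

theorem dropLast_mem_vt {γ : (X.raise ω M₁ M₂).Index} {ρ : Fin (p + 1) → ℝ}
    (h : ρ ∈ (X.raise ω M₁ M₂).vt γ) : dropLast ρ ∈ X.vt γ.1 :=
  (mem_raise_vt.mp h).1

theorem exists_int_of_mem_raise_vt {γ : (X.raise ω M₁ M₂).Index} {ρ : Fin (p + 1) → ℝ}
    (h : ρ ∈ (X.raise ω M₁ M₂).vt γ) : ∃ m : ℤ, ρ (Fin.last p) = m := by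
  obtain ⟨α, v, k⟩ := γ
  obtain ⟨-, ⟨-, h⟩ | ⟨-, h⟩⟩ := mem_raise_vt.mp h <;>
  obtain ⟨m, hm⟩ := exists_int_upperFract_sub (ω (dropLast ρ)) <;>
  rw [level_apply] at h
  · exact ⟨m + k.1, by push_cast; linarith⟩
  · exact ⟨m + k.1 - 1, by push_cast; linarith⟩

theorem raise_lt {γ : (X.raise ω M₁ M₂).Index} {ρ ρ' : Fin (p + 1) → ℝ} :
    (X.raise ω M₁ M₂).lt γ ρ ρ' ↔ X.lt γ.1 (dropLast ρ) (dropLast ρ') ∨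
      (dropLast ρ = dropLast ρ' ∧ ρ' (Fin.last p) < ρ (Fin.last p)) := by
  rw [funext_iff]
  rfl

namespace IsTorusComplex

theorem ltA_irrefl (h : X.IsTorusComplex Λ) (α : X.Index) :
    ∀ u ∈ X.vt α, ¬ X.ltA ω α u u := by
  rintro u hu (h' | h')
  exacts [lt_irrefl _ h', h.irrefl α u hu h'.2]

theorem ltA_trans (h : X.IsTorusComplex Λ) (α : X.Index) :
    ∀ u ∈ X.vt α, ∀ v ∈ X.vt α, ∀ w ∈ X.vt α,
      X.ltA ω α u v → X.ltA ω α v w → X.ltA ω α u w := by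
  rintro u hu v hv w hw (h1 | ⟨h1, h1'⟩) (h2 | ⟨h2, h2'⟩)
  · exact .inl (h1.trans h2)
  · exact .inl (h1.trans_eq h2)
  · exact .inl (h1.trans_lt h2)
  · exact .inr ⟨h1.trans h2, h.trans α u hu v hv w hw h1' h2'⟩

theorem ltA_total (h : X.IsTorusComplex Λ) (α : X.Index) :
    ∀ u ∈ X.vt α, ∀ v ∈ X.vt α, X.ltA ω α u v ∨ u = v ∨ X.ltA ω α v u := by
  intro u hu v hv
  rcases lt_trichotomy (upperFract (ω u)) (upperFract (ω v)) with h' | h' | h'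
  · exact .inl (.inl h')
  · rcases h.total α u hu v hv with h1 | h1 | h1
    · exact .inl (.inr ⟨h', h1⟩)
    · exact .inr (.inl h1)
    · exact .inr (.inr (.inr ⟨h'.symm, h1⟩))
  · exact .inr (.inr (.inl h'))

theorem eq_of_leA_of_leA (h : X.IsTorusComplex Λ) (α : X.Index) {u v : Fin p → ℝ}
    (hu : u ∈ X.vt α) (hv : v ∈ X.vt α) (h1 : u = v ∨ X.ltA ω α u v)
    (h2 : u = v ∨ X.ltA ω α v u) : u = v := by
  rcases h1 with h1 | h1
  · exact h1
  rcases h2 with h2 | h2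
  · exact h2
  exact (h.ltA_irrefl α u hu (h.ltA_trans α u hu v hv u hu h1 h2)).elim

theorem asymm (h : X.IsTorusComplex Λ) (α : X.Index) {u v : Fin p → ℝ}
    (hu : u ∈ X.vt α) (hv : v ∈ X.vt α) (h1 : X.lt α u v) : ¬ X.lt α v u := fun h2 =>
  h.irrefl α u hu (h.trans α u hu v hv u hu h1 h2)

/-- Since `A` takes values in `(0, 1]`, the bound is strict unless `ρ` is an upper vertex and `ρ'` a
lower one. Then the base of `ρ` is at most `v` and that of `ρ'` at least `v` in `≺^A`; a level
difference of exactly one means equal `A`, where `≺^A` is `≺`. -/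
theorem atMostOneAbove (h : X.IsTorusComplex Λ) {γ : (X.raise ω M₁ M₂).Index}
    {ρ ρ' : Fin (p + 1) → ℝ} (hρ : ρ ∈ (X.raise ω M₁ M₂).vt γ)
    (hρ' : ρ' ∈ (X.raise ω M₁ M₂).vt γ) :
    AtMostOneAbove dropLast (level ω) (X.lt γ.1) ρ ρ' := by
  obtain ⟨α, v, k⟩ := γ
  obtain ⟨hu, hc⟩ := mem_raise_vt.mp hρ
  obtain ⟨hu', hc'⟩ := mem_raise_vt.mp hρ'
  have p1 := upperFract_pos (ω (dropLast ρ'))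
  have p2 := upperFract_le_one (ω (dropLast ρ))
  have p3 := upperFract_pos (ω (dropLast ρ))
  rcases hc with ⟨h1, e1⟩ | ⟨h1, e1⟩ <;> rcases hc' with ⟨h2, e2⟩ | ⟨h2, e2⟩
  · exact .inl (by linarith)
  · have : dropLast ρ = dropLast ρ' ∨ X.ltA ω α (dropLast ρ) (dropLast ρ') := by
      rcases h1 with h1 | h1 <;> rcases h2 with h2 | h2
      · exact .inl (h1.trans h2.symm)
      · rw [h1]; exact .inr h2
      · rw [h2]; exact .inr h1
      · exact .inr (h.ltA_trans α _ hu _ v.2 _ hu' h1 h2)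
    rcases this with h3 | h3 | ⟨h3, h3'⟩
    · exact .inr ⟨by rw [e1, e2, h3]; ring, .inl h3⟩
    · exact .inl (by linarith)
    · exact .inr ⟨by linarith, .inr h3'⟩
  · exact .inl (by linarith)
  · exact .inl (by linarith)

theorem card_raise_vt (h : X.IsTorusComplex Λ) (γ : (X.raise ω M₁ M₂).Index) :
    ((X.raise ω M₁ M₂).vt γ).card = p + 1 + 1 := by
  classical
  obtain ⟨α, v, k⟩ := γ
  have hinj : ∀ t : (Fin p → ℝ) → ℝ, Function.Injective
      fun u : Fin p → ℝ => (Fin.snoc (α := fun _ => ℝ) u (t u) : Fin (p + 1) → ℝ) :=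
    fun t u u' huu' => by simpa using congrArg dropLast huu'
  simp only [raise]
  rw [Finset.card_union_of_disjoint, Finset.card_image_of_injective _ (hinj _),
    Finset.card_image_of_injective _ (hinj _), ← Finset.card_union_add_card_inter]
  · have hU : (X.vt α).filter (fun u => u = v.1 ∨ X.ltA ω α u v.1) ∪
        (X.vt α).filter (fun u => u = v.1 ∨ X.ltA ω α v.1 u) = X.vt α := by
      rw [← Finset.filter_or, Finset.filter_true_of_mem]
      intro u hu
      rcases h.ltA_total (ω := ω) α u hu v.1 v.2 with h' | h' | h' <;> tauto
    have hI : (X.vt α).filter (fun u => u = v.1 ∨ X.ltA ω α u v.1) ∩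
        (X.vt α).filter (fun u => u = v.1 ∨ X.ltA ω α v.1 u) = {v.1} := by
      ext u
      simp only [Finset.mem_inter, Finset.mem_filter, Finset.mem_singleton]
      constructor
      · rintro ⟨⟨hu, h1⟩, -, h2⟩
        exact h.eq_of_leA_of_leA α hu v.2 h1 h2
      · rintro rfl
        exact ⟨⟨v.2, .inl rfl⟩, v.2, .inl rfl⟩
    rw [hU, hI, h.card_vt, Finset.card_singleton]
  · rw [Finset.disjoint_left]
    intro ρ h1 h2
    obtain ⟨u, -, rfl⟩ := Finset.mem_image.mp h1
    obtain ⟨u', -, he⟩ := Finset.mem_image.mp h2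
    have h3 := congrArg dropLast he
    have h4 := congrFun he (Fin.last p)
    simp only [dropLast_snoc, Fin.snoc_last] at h3 h4
    subst h3
    linarith

/-- The translate of `c` and `c'` have the same marginal on the base by `coords` for `X`, and the
same mean level because both have centroid `x + l`. Translation shifts levels by a constant and
respects `≺` by `invariant`, so both supports are at most one apart. -/
theorem raise_coords (h : X.IsTorusComplex Λ) {γ γ' : (X.raise ω M₁ M₂).Index}
    {x l : Fin (p + 1) → ℝ} {c c' : (Fin (p + 1) → ℝ) →₀ ℝ} (hl : dropLast l ∈ Λ)
    (hl' : ∃ m : ℤ, l (Fin.last p) = m) (hc : IsBarycentric ((X.raise ω M₁ M₂).vt γ) x c)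
    (hc' : IsBarycentric ((X.raise ω M₁ M₂).vt γ') (x + l) c') :
    c' = c.mapDomain fun v => v + l := by
  classical
  have hs := hc.mapDomain LinearMap.id l
    (T := ((X.raise ω M₁ M₂).vt γ).image fun v => v + l) fun v hv =>
      Finset.mem_image_of_mem _ hv
  simp only [LinearMap.id_apply] at hs
  have hd := hc.mapDomain dropLast 0 (T := X.vt γ.1) fun v hv => by
    simpa using dropLast_mem_vt hv
  have hd' := hc'.mapDomain dropLast 0 (T := X.vt γ'.1) fun v hv => by
    simpa using dropLast_mem_vt hv
  simp only [add_zero, map_add] at hd hd'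
  have hm := h.coords _ _ _ _ _ _ hl hd hd'
  rw [← Finsupp.mapDomain_comp] at hm
  have hm' : Finsupp.mapDomain dropLast c' =
      Finsupp.mapDomain dropLast (c.mapDomain fun v => v + l) := by
    rw [← Finsupp.mapDomain_comp]
    exact hm
  have hbase : ∀ ρ ∈ (c.mapDomain fun v => v + l).support, dropLast ρ ∈ X.vt γ'.1 := by
    intro ρ hρ
    refine hd'.support_subset ?_
    rw [hm']
    exact Finsupp.apply_mem_support_mapDomain _ hs.nonneg hρ
  have hshift : ∀ ρ ∈ (c.mapDomain fun v => v + l).support,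
      ∃ ρ₀ ∈ (X.raise ω M₁ M₂).vt γ, ρ₀ + l = ρ := fun ρ hρ =>
    Finset.mem_image.mp (hs.support_subset hρ)
  refine Finsupp.eq_of_marginal_eq_of_atMostOneAbove (f := dropLast) (L := level ω)
    (lt := X.lt γ'.1) (D := {ρ | dropLast ρ ∈ X.vt γ'.1 ∧ ∃ m : ℤ, ρ (Fin.last p) = m})
    ?_ ?_ ?_ ?_ ?_ hc'.nonneg hs.nonneg ?_ ?_ hm' ?_
  · intro ρ hρ
    have := hc'.support_subset hρ
    exact ⟨dropLast_mem_vt this, exists_int_of_mem_raise_vt this⟩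
  · intro ρ hρ
    refine ⟨hbase ρ hρ, ?_⟩
    obtain ⟨ρ₀, hρ₀, rfl⟩ := hshift ρ hρ
    obtain ⟨m, hm⟩ := exists_int_of_mem_raise_vt hρ₀
    obtain ⟨m', hm'⟩ := hl'
    exact ⟨m + m', by rw [Pi.add_apply, hm, hm']; push_cast; rfl⟩
  · exact fun ρ hρ ρ' hρ' => h.asymm _ hρ.1 hρ'.1
  · intro ρ _ ρ' _ h1 h2
    rw [level_apply, level_apply, h1] at h2
    exact ext_dropLast h1 (by linarith)
  · rintro ρ ⟨-, m, hm⟩ ρ' ⟨-, m', hm'⟩ h1 h2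
    rw [level_apply, level_apply, h1, hm, hm'] at h2 ⊢
    have h3 : (m : ℝ) < m' := by linarith
    have h4 : ((m + 1 : ℤ) : ℝ) ≤ m' := by exact_mod_cast h3
    push_cast at h4
    linarith
  · exact fun ρ hρ ρ' hρ' =>
      h.atMostOneAbove (hc'.support_subset hρ) (hc'.support_subset hρ')
  · intro ρ hρ ρ' hρ'
    have hb := hbase ρ hρ
    have hb' := hbase ρ' hρ'
    obtain ⟨ρ₀, hρ₀, rfl⟩ := hshift ρ hρ
    obtain ⟨ρ₀', hρ₀', rfl⟩ := hshift ρ' hρ'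
    rw [map_add] at hb hb'
    have ht := h.atMostOneAbove hρ₀ hρ₀'
    unfold AtMostOneAbove at ht ⊢
    rw [h.invariant _ _ _ (dropLast_mem_vt hρ₀) _ (dropLast_mem_vt hρ₀') _ hl hb hb'] at ht
    simp only [map_add]
    rcases ht with ht | ⟨ht, h1⟩
    · exact .inl (by linarith)
    · exact .inr ⟨by linarith, h1.imp (fun h1 => by rw [h1]) id⟩
  · have key : ∀ d : (Fin (p + 1) → ℝ) →₀ ℝ, Finsupp.linearCombination ℝ (level ω) d =
        level ω (Finsupp.linearCombination ℝ id d) := fun d => by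
      rw [Finsupp.apply_linearCombination]; rfl
    rw [key, key, hc'.centroid, hs.centroid]

theorem exists_mem_raise_vt (h : X.IsTorusComplex Λ) (γ : (X.raise ω M₁ M₂).Index)
    {u : Fin p → ℝ} (hu : u ∈ X.vt γ.1) : ∃ ρ ∈ (X.raise ω M₁ M₂).vt γ, dropLast ρ = u := by
  obtain ⟨α, v, k⟩ := γ
  rcases h.ltA_total (ω := ω) α u hu v.1 v.2 with h' | h'
  · refine ⟨Fin.snoc (α := fun _ => ℝ) u (upperFract (ω u) - ω u + k.1),
      mem_raise_vt.mpr ?_, dropLast_snoc _ _⟩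
    rw [level_apply, dropLast_snoc, Fin.snoc_last]
    exact ⟨hu, .inl ⟨.inr h', by ring⟩⟩
  · refine ⟨Fin.snoc (α := fun _ => ℝ) u (upperFract (ω u) - ω u + k.1 - 1),
      mem_raise_vt.mpr ?_, dropLast_snoc _ _⟩
    rw [level_apply, dropLast_snoc, Fin.snoc_last]
    exact ⟨hu, .inr ⟨h', by ring⟩⟩

/-- Only the distinguished vertex `v` has two lifts, so the vertex set determines `v`, and the
heights of these lifts determine `ℓ`. Two values of `ℓ` in `[M₁, M₂)` differing by a multiple of `M₂
- M₁` are equal. -/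
theorem raise_rigid (h : X.IsTorusComplex Λ) {γ γ' : (X.raise ω M₁ M₂).Index}
    {l : Fin (p + 1) → ℝ} (hl : dropLast l ∈ Λ)
    (hl' : ∃ m : ℤ, l (Fin.last p) = m * (M₂ - M₁))
    (hvt : ∀ ρ ∈ (X.raise ω M₁ M₂).vt γ, ρ + l ∈ (X.raise ω M₁ M₂).vt γ') :
    γ = γ' ∧ l = 0 := by
  have hb : γ.1 = γ'.1 ∧ dropLast l = 0 := h.rigid _ _ _ hl fun u hu => by
    obtain ⟨ρ, hρ, rfl⟩ := h.exists_mem_raise_vt γ hu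
    rw [← map_add]
    exact dropLast_mem_vt (hvt ρ hρ)
  obtain ⟨α, v, k⟩ := γ
  obtain ⟨β, w, k'⟩ := γ'
  obtain ⟨hαβ, hl0⟩ := hb
  dsimp only at hαβ
  subst hαβ
  obtain ⟨m, hm⟩ := hl'
  have hup := hvt (Fin.snoc (α := fun _ => ℝ) v.1 (upperFract (ω v.1) - ω v.1 + k.1))
    (mem_raise_vt.mpr (by
      rw [level_apply, dropLast_snoc, Fin.snoc_last]
      exact ⟨v.2, .inl ⟨.inl rfl, by ring⟩⟩))
  have hlo := hvt (Fin.snoc (α := fun _ => ℝ) v.1 (upperFract (ω v.1) - ω v.1 + k.1 - 1))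
    (mem_raise_vt.mpr (by
      rw [level_apply, dropLast_snoc, Fin.snoc_last]
      exact ⟨v.2, .inr ⟨.inl rfl, by ring⟩⟩))
  rw [mem_raise_vt, level_apply, map_add, dropLast_snoc, hl0, add_zero, Pi.add_apply,
    Fin.snoc_last, hm] at hup hlo
  have hkey : v.1 = w.1 ∧ (k.1 : ℝ) + m * (M₂ - M₁) = k'.1 := by
    rcases hup.2 with ⟨h1, e1⟩ | ⟨h1, e1⟩ <;> rcases hlo.2 with ⟨h2, e2⟩ | ⟨h2, e2⟩
    · linarith
    · exact ⟨h.eq_of_leA_of_leA α v.2 w.2 h1 h2, by linarith⟩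
    · linarith
    · linarith
  obtain ⟨hvw, hk⟩ := hkey
  have hk : k.1 + m * (M₂ - M₁) = k'.1 := by exact_mod_cast hk
  have hm0 : m = 0 := by
    have h1 := k.2
    have h2 := k'.2
    rcases lt_trichotomy m 0 with h3 | h3 | h3
    · nlinarith
    · exact h3
    · nlinarith
  rw [hm0, zero_mul, add_zero] at hk
  refine ⟨?_, ext_dropLast (by simpa using hl0) (by rw [hm, hm0]; simp)⟩
  rw [Subtype.ext hvw, Subtype.ext hk]

/-- The same `v` and `k` serve all integer shifts `m` of the height, so that `k + m` can later be
moved into `[M₁, M₂)`. -/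
theorem exists_mem_raise_simplex (h : X.IsTorusComplex Λ) {α : X.Index} {x : Fin p → ℝ}
    (hx : x ∈ X.simplex α) (t : ℝ) : ∃ v : {v // v ∈ X.vt α}, ∃ k : ℤ, ∀ m : ℤ,
      ∀ hm : M₁ ≤ k + m ∧ k + m < M₂, (Fin.snoc (α := fun _ => ℝ) x (t + m) : Fin (p + 1) → ℝ) ∈
        (X.raise ω M₁ M₂).simplex ⟨α, v, ⟨k + m, hm⟩⟩ := by
  classical
  obtain ⟨c, hc⟩ := mem_convexHull_iff_exists_isBarycentric.mp hx
  set n : (Fin p → ℝ) → ℝ := fun u => upperFract (ω u) - ω u with hn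
  -- `T` is the height above the combination of the lifts `n u`. Its fractional part is attained by
  -- lifting the vertices before `v` by one and `v` by `θ`.
  set T := t - ∑ u ∈ X.vt α, c u * n u with hT
  obtain ⟨v, hv, θ, hθ0, hθ1, hθ⟩ := exists_eq_sum_filter_add_mul (h.ltA_irrefl (ω := ω) α)
    (h.ltA_trans α) (h.ltA_total α) hc.sum_eq_one
    (Int.fract_nonneg T) (Int.fract_lt_one T)
  -- The lower lifts carry `ℓ - 1`, hence `ℓ = ⌊T⌋ + 1` before shifting.
  refine ⟨⟨v, hv⟩, ⌊T⌋ + 1, fun m hm => ?_⟩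
  set e : (Fin p → ℝ) → ℝ := fun u => (if X.ltA ω α u v then 1 else 0) + if u = v then θ else 0
    with he
  have hsum : ∑ u ∈ X.vt α, c u * e u = Int.fract T := by
    rw [hθ]
    simp only [he, mul_add, mul_ite, mul_one, mul_zero, Finset.sum_add_distrib,
      Finset.sum_ite_eq', if_pos hv, Finset.sum_filter]
    ring
  have hrep : (Fin.snoc (α := fun _ => ℝ) x (t + m) : Fin (p + 1) → ℝ) = ∑ u ∈ X.vt α, c u •
      (Fin.snoc (α := fun _ => ℝ) u (n u + ⌊T⌋ + m + e u) : Fin (p + 1) → ℝ) := by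
    refine ext_dropLast ?_ ?_
    · simp only [map_sum, map_smul, dropLast_snoc, hc.sum_smul_eq]
    · simp only [Finset.sum_apply, Pi.smul_apply, Fin.snoc_last, smul_eq_mul, mul_add,
        Finset.sum_add_distrib, hsum, ← Finset.sum_mul, hc.sum_eq_one]
      have := Int.floor_add_fract T
      linarith
  rw [hrep]
  refine (convex_convexHull ℝ _).sum_mem (fun u _ => hc.nonneg u) hc.sum_eq_one fun u hu => ?_
  have hupp : u = v ∨ X.ltA ω α u v → (Fin.snoc (α := fun _ => ℝ) u (n u + ⌊T⌋ + m + 1) :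
      Fin (p + 1) → ℝ) ∈ (X.raise ω M₁ M₂).simplex ⟨α, ⟨v, hv⟩, ⟨⌊T⌋ + 1 + m, hm⟩⟩ := by
    refine fun h' => subset_convexHull ℝ _ (Finset.mem_coe.mpr (mem_raise_vt.mpr ?_))
    rw [level_apply, dropLast_snoc, Fin.snoc_last]
    exact ⟨hu, .inl ⟨h', by simp only [hn]; push_cast; ring⟩⟩
  have hlow : u = v ∨ X.ltA ω α v u → (Fin.snoc (α := fun _ => ℝ) u (n u + ⌊T⌋ + m) :
      Fin (p + 1) → ℝ) ∈ (X.raise ω M₁ M₂).simplex ⟨α, ⟨v, hv⟩, ⟨⌊T⌋ + 1 + m, hm⟩⟩ := by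
    refine fun h' => subset_convexHull ℝ _ (Finset.mem_coe.mpr (mem_raise_vt.mpr ?_))
    rw [level_apply, dropLast_snoc, Fin.snoc_last]
    exact ⟨hu, .inr ⟨h', by simp only [hn]; push_cast; ring⟩⟩
  rcases h.ltA_total (ω := ω) α u hu v hv with h' | rfl | h'
  · have hne : u ≠ v := by rintro rfl; exact h.ltA_irrefl α u hu h'
    have : e u = 1 := by simp [he, h', hne]
    rw [this]
    exact hupp (.inr h')
  · have hself : e u = θ := by simp [he, h.ltA_irrefl α u hu]
    have := convex_convexHull ℝ _ (hlow (.inl rfl)) (hupp (.inl rfl)) (sub_nonneg.mpr hθ1) hθ0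
      (by ring)
    convert this using 1
    refine ext_dropLast ?_ ?_
    · simp only [map_add, map_smul, dropLast_snoc]
      module
    · simp only [Pi.add_apply, Pi.smul_apply, Fin.snoc_last, smul_eq_mul, hself]
      ring
  · have hne : u ≠ v := by rintro rfl; exact h.ltA_irrefl α u hu h'
    have hnlt : ¬ X.ltA ω α u v := fun h'' =>
      h.ltA_irrefl α u hu (h.ltA_trans α u hu v hv u hu h'' h')
    have : e u = 0 := by simp [he, hnlt, hne]
    rw [this, add_zero]
    exact hlow (.inr h')

theorem raise (h : X.IsTorusComplex Λ) (ω : (Fin p → ℝ) →ₗ[ℝ] ℝ) (hM : M₁ < M₂)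
    {Λ' : AddSubgroup (Fin (p + 1) → ℝ)}
    (hΛ' : ∀ l, l ∈ Λ' ↔ dropLast l ∈ Λ ∧ ∃ m : ℤ, l (Fin.last p) = m * (M₂ - M₁)) :
    (X.raise ω M₁ M₂).IsTorusComplex Λ' where
  card_vt := h.card_raise_vt
  irrefl := by
    intro γ ρ hρ hlt
    rcases raise_lt.mp hlt with h1 | h1
    · exact h.irrefl _ _ (dropLast_mem_vt hρ) h1
    · exact lt_irrefl _ h1.2
  trans := by
    intro γ u hu v hv w hw huv hvw
    rw [raise_lt] at huv hvw ⊢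
    rcases huv with h1 | ⟨h1, h1'⟩ <;> rcases hvw with h2 | ⟨h2, h2'⟩
    · exact .inl (h.trans _ _ (dropLast_mem_vt hu) _ (dropLast_mem_vt hv) _
        (dropLast_mem_vt hw) h1 h2)
    · exact .inl (h2 ▸ h1)
    · exact .inl (h1 ▸ h2)
    · exact .inr ⟨h1.trans h2, h2'.trans h1'⟩
  total := by
    intro γ u hu v hv
    rw [raise_lt, raise_lt]
    rcases h.total _ _ (dropLast_mem_vt hu) _ (dropLast_mem_vt hv) with h1 | h1 | h1
    · exact .inl (.inl h1)
    · rcases lt_trichotomy (u (Fin.last p)) (v (Fin.last p)) with h2 | h2 | h2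
      · exact .inr (.inr (.inr ⟨h1.symm, h2⟩))
      · exact .inr (.inl (ext_dropLast h1 h2))
      · exact .inl (.inr ⟨h1, h2⟩)
    · exact .inr (.inr (.inl h1))
  invariant := by
    intro γ γ' v hv w hw l hl hvl hwl
    have hv' := dropLast_mem_vt hvl
    have hw' := dropLast_mem_vt hwl
    rw [map_add] at hv' hw'
    rw [raise_lt, raise_lt, h.invariant _ _ _ (dropLast_mem_vt hv) _ (dropLast_mem_vt hw) _
      ((hΛ' l).mp hl).1 hv' hw']
    simp
  coords := by
    intro γ γ' x c c' l hl hc hc'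
    obtain ⟨hl, m, hm⟩ := (hΛ' l).mp hl
    exact h.raise_coords hl ⟨m * (M₂ - M₁), by rw [hm]; push_cast; rfl⟩ hc hc'
  rigid := fun γ γ' l hl hvt => h.raise_rigid ((hΛ' l).mp hl).1 ((hΛ' l).mp hl).2 hvt
  cover := by
    intro x
    obtain ⟨l, hl, α, hα⟩ := h.cover (dropLast x)
    obtain ⟨v, k, hk⟩ := h.exists_mem_raise_simplex (ω := ω) (M₁ := M₁) (M₂ := M₂) hα
      (x (Fin.last p))
    -- A lattice translation in the last coordinate reduces `k` modulo `M₂ - M₁` into `[M₁, M₂)`.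
    have hdiv := Int.emod_add_mul_ediv (k - M₁) (M₂ - M₁)
    have h0 := Int.emod_nonneg (k - M₁) (sub_pos.mpr hM).ne'
    have h1 := Int.emod_lt_of_pos (k - M₁) (sub_pos.mpr hM)
    set m := -((k - M₁) / (M₂ - M₁)) with hm
    have hmul : m * (M₂ - M₁) = (k - M₁) % (M₂ - M₁) - (k - M₁) := by rw [hm]; linarith
    have := hk (m * (M₂ - M₁)) ⟨by omega, by omega⟩
    refine ⟨Fin.snoc (α := fun _ => ℝ) l (m * (M₂ - M₁)), (hΛ' _).mpr ?_,
      ⟨α, v, ⟨k + m * (M₂ - M₁), by omega, by omega⟩⟩, ?_⟩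
    rotate_left
    · convert this using 1
      refine ext_dropLast (by simp) ?_
      simp
    · rw [dropLast_snoc, Fin.snoc_last]
      exact ⟨hl, m, rfl⟩

end IsTorusComplex

end OrderedComplex

/-! ### The lattice, one coordinate at a time. -/

section BoxLattice

theorem mem_pi_zmultiples_iff {p : ℕ} (d : Fin (p + 1) → ℝ) (l : Fin (p + 1) → ℝ) :
    l ∈ AddSubgroup.pi Set.univ (fun i => AddSubgroup.zmultiples (d i)) ↔
      dropLast l ∈ AddSubgroup.pi Set.univ (fun i => AddSubgroup.zmultiples (d i.castSucc)) ∧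
        ∃ m : ℤ, l (Fin.last p) = m * d (Fin.last p) := by
  simp only [AddSubgroup.mem_pi, Set.mem_univ, true_imp_iff, AddSubgroup.mem_zmultiples_iff]
  rw [Fin.forall_fin_succ']
  refine and_congr Iff.rfl ⟨fun ⟨m, hm⟩ => ⟨m, by simpa using hm.symm⟩,
    fun ⟨m, hm⟩ => ⟨m, by simpa using hm.symm⟩⟩

theorem mem_boxLattice_succ_iff (r : ℕ) {j : ℕ} (N : Fin (j + 1) → ℕ) (l : Fin (r + j + 1) → ℝ) :
    l ∈ boxLattice r N ↔ dropLast l ∈ boxLattice r (fun i : Fin j => N i.castSucc) ∧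
      ∃ m : ℤ, l (Fin.last (r + j)) = m * N (Fin.last j) := by
  have hlast : Fin.append (fun _ : Fin r => (1 : ℝ)) (fun i => (N i : ℝ)) (Fin.last (r + j)) =
      N (Fin.last j) :=
    Fin.append_right (m := r) (n := j + 1) (fun _ => (1 : ℝ)) (fun i => (N i : ℝ)) (Fin.last j)
  have hinit : ∀ i : Fin (r + j),
      Fin.append (fun _ : Fin r => (1 : ℝ)) (fun i => (N i : ℝ)) i.castSucc =
        Fin.append (fun _ : Fin r => (1 : ℝ)) (fun i : Fin j => (N i.castSucc : ℝ)) i := by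
    intro i
    refine Fin.addCases (fun i => ?_) (fun i => ?_) i
    · rw [Fin.append_left]
      exact Fin.append_left (m := r) (n := j + 1) (fun _ => (1 : ℝ)) (fun i => (N i : ℝ)) i
    · rw [Fin.append_right]
      exact Fin.append_right (m := r) (n := j + 1) (fun _ => (1 : ℝ)) (fun i => (N i : ℝ))
        i.castSucc
  refine (mem_pi_zmultiples_iff (p := r + j)
    (Fin.append (m := r) (n := j + 1) (fun _ => (1 : ℝ)) (fun i => (N i : ℝ))) l).trans ?_
  rw [hlast]
  simp only [hinit]
  rfl

theorem mem_boxLattice_zero_iff (r : ℕ) (N : Fin 0 → ℕ) (l : Fin r → ℝ) :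
    l ∈ boxLattice r N ↔
      l ∈ AddSubgroup.pi Set.univ (fun _ : Fin r => AddSubgroup.zmultiples (1 : ℝ)) := by
  have h : ∀ i : Fin r,
      Fin.append (fun _ : Fin r => (1 : ℝ)) (fun i : Fin 0 => (N i : ℝ)) i = 1 := fun i =>
    Fin.append_left (fun _ : Fin r => (1 : ℝ)) (fun i : Fin 0 => (N i : ℝ)) i
  simp only [boxLattice, AddSubgroup.mem_pi, Set.mem_univ, true_imp_iff]
  exact forall_congr' fun i => by rw [← congrArg AddSubgroup.zmultiples (h i)]

variable (r : ℕ) {r₂ : ℕ} (N : Fin r₂ → ℕ)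

theorem append_one_eq_natCast (i : Fin (r + r₂)) :
    Fin.append (fun _ : Fin r => (1 : ℝ)) (fun j => (N j : ℝ)) i =
      (Fin.append (fun _ : Fin r => 1) N i : ℕ) := by
  refine Fin.addCases (fun i => ?_) (fun i => ?_) i
  · simp
  · simp

theorem discreteTopology_boxLattice : DiscreteTopology (boxLattice r N) := by
  refine discreteTopology_of_isOpen_singleton_zero ?_
  -- Lattice points have integer coordinates, so only zero has sup norm below one.
  have h : (Subtype.val ⁻¹' Metric.ball 0 1 : Set (boxLattice r N)) = {0} := by
    ext ⟨x, hx⟩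
    simp only [Set.mem_preimage, mem_ball_zero_iff, Set.mem_singleton_iff,
      AddSubgroup.mk_eq_zero]
    constructor
    · intro h1
      ext i
      have h2 := (norm_le_pi_norm x i).trans_lt h1
      obtain ⟨m, hm⟩ := AddSubgroup.mem_zmultiples_iff.mp (hx i (Set.mem_univ i))
      rw [append_one_eq_natCast, zsmul_eq_mul] at hm
      rw [← hm, Real.norm_eq_abs, ← Int.cast_natCast (R := ℝ), ← Int.cast_mul, ← Int.cast_abs] at h2
      have h3 := Int.abs_lt_one_iff.mp (by exact_mod_cast h2)
      rw [← hm, ← Int.cast_natCast (R := ℝ), ← Int.cast_mul, h3]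
      simp
    · rintro rfl
      simp
  rw [← h]
  exact Metric.isOpen_ball.preimage continuous_subtype_val

theorem span_boxLattice (hN : ∀ j, N j ≠ 0) :
    Submodule.span ℝ (boxLattice r N : Set (Fin (r + r₂) → ℝ)) = ⊤ := by
  refine eq_top_iff.mpr fun x _ => ?_
  set d := Fin.append (fun _ : Fin r => (1 : ℝ)) (fun j => (N j : ℝ)) with hd
  have hd0 : ∀ i, d i ≠ 0 := by
    refine Fin.addCases (fun i => ?_) (fun i => ?_)
    · simp [hd]
    · simpa [hd] using hN i
  have hx : x = ∑ i, (x i / d i) • Pi.single i (d i) := by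
    ext k
    simp [Finset.sum_apply, Pi.single_apply, hd0 k]
  rw [hx]
  refine Submodule.sum_mem _ fun i _ => Submodule.smul_mem _ _ (Submodule.subset_span ?_)
  intro k _
  rcases eq_or_ne k i with rfl | hk
  · rw [Pi.single_eq_same]
    exact AddSubgroup.mem_zmultiples _
  · rw [Pi.single_eq_of_ne hk]
    exact AddSubgroup.zero_mem _

end BoxLattice

/-! ### Level bounds, integrality and counting for one raising. -/

namespace OrderedComplex

variable {p : ℕ} {X : OrderedComplex (Fin p → ℝ)} {ω : (Fin p → ℝ) →ₗ[ℝ] ℝ} {M₁ M₂ : ℤ}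

theorem exists_level_mem_Icc (γ : (X.raise ω M₁ M₂).Index) :
    ∃ a : ℝ, ∀ ρ ∈ (X.raise ω M₁ M₂).vt γ, level ω ρ ∈ Set.Icc a (a + 1) := by
  obtain ⟨α, v, k⟩ := γ
  -- The two lifts of `v` are the extremes: `A` is at most `A(v)` where the upper lift is used and
  -- at least `A(v)` where the lower one is.
  refine ⟨upperFract (ω v.1) + k.1 - 1, fun ρ hρ => ?_⟩
  have p0 := upperFract_pos (ω (dropLast ρ))
  have p1 := upperFract_le_one (ω (dropLast ρ))
  have p2 := upperFract_pos (ω v.1)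
  have p3 := upperFract_le_one (ω v.1)
  obtain ⟨-, ⟨h, e⟩ | ⟨h, e⟩⟩ := mem_raise_vt.mp hρ
  · have : upperFract (ω (dropLast ρ)) ≤ upperFract (ω v.1) := by
      rcases h with h | h | h
      exacts [by rw [h], h.le, h.1.le]
    constructor <;> linarith
  · have : upperFract (ω v.1) ≤ upperFract (ω (dropLast ρ)) := by
      rcases h with h | h | h
      exacts [by rw [h], h.le, h.1.le]
    constructor <;> linarith

theorem raise_integral (h : ∀ α, ∀ v ∈ X.vt α, ∀ i, ∃ m : ℤ, v i = m)
    (γ : (X.raise ω M₁ M₂).Index) : ∀ ρ ∈ (X.raise ω M₁ M₂).vt γ, ∀ i, ∃ m : ℤ, ρ i = m := by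
  intro ρ hρ i
  refine Fin.lastCases (exists_int_of_mem_raise_vt hρ) (fun i => ?_) i
  exact h γ.1 _ (dropLast_mem_vt hρ) i

theorem card_int_subtype (M₁ M₂ : ℤ) :
    Finite {k : ℤ // M₁ ≤ k ∧ k < M₂} ∧
      Nat.card {k : ℤ // M₁ ≤ k ∧ k < M₂} = (M₂ - M₁).toNat :=
  ⟨(Set.finite_Ico M₁ M₂).to_subtype,
    (Nat.subtype_card (Finset.Ico M₁ M₂) fun _ => Finset.mem_Ico).trans (Int.card_Ico _ _)⟩

theorem finite_raise_index [Finite X.Index] : Finite (X.raise ω M₁ M₂).Index := by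
  have := (card_int_subtype M₁ M₂).1
  exact inferInstanceAs
    (Finite (Σ α : X.Index, {v // v ∈ X.vt α} × {ℓ : ℤ // M₁ ≤ ℓ ∧ ℓ < M₂}))

theorem card_raise_index [Finite X.Index] (h : ∀ α, (X.vt α).card = p + 1) :
    Nat.card (X.raise ω M₁ M₂).Index = Nat.card X.Index * ((p + 1) * (M₂ - M₁).toNat) := by
  have := Fintype.ofFinite X.Index
  have hf := (card_int_subtype M₁ M₂).1
  have e : Nat.card (X.raise ω M₁ M₂).Index =
    Nat.card (Σ α : X.Index, {v // v ∈ X.vt α} × {ℓ : ℤ // M₁ ≤ ℓ ∧ ℓ < M₂}) := rfl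
  rw [e, Nat.card_sigma]
  simp only [Nat.card_prod, (card_int_subtype M₁ M₂).2,
    Nat.card_eq_fintype_card, Fintype.card_coe, h, Finset.sum_const, Finset.card_univ, smul_eq_mul]

end OrderedComplex

/-! ### Induction along the cube and the tower. -/

theorem isTorusComplex_trivialComplex (Λ : AddSubgroup (Fin 0 → ℝ)) :
    trivialComplex.IsTorusComplex Λ where
  card_vt _ := rfl
  irrefl _ _ _ := id
  trans _ _ _ _ _ _ _ h := h.elim
  total _ u _ v _ := .inr (.inl (Subsingleton.elim u v))
  invariant _ _ _ _ _ _ _ _ _ _ := Iff.rfl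
  coords := by
    intro α β x c c' l _ hc hc'
    have hs := hc.mapDomain LinearMap.id l (T := {0}) fun v _ =>
      Finset.mem_singleton.mpr (Subsingleton.elim _ _)
    have h1 := hs.sum_eq_one
    have h2 : ∑ u ∈ {0}, c' u = 1 := hc'.sum_eq_one
    rw [Finset.sum_singleton] at h1 h2
    refine Finsupp.ext fun v => ?_
    rw [Subsingleton.elim v 0]
    exact h2.trans h1.symm
  rigid _ _ _ _ _ := ⟨rfl, Subsingleton.elim _ _⟩
  cover x := ⟨0, Λ.zero_mem, (), by
    rw [Subsingleton.elim (x + 0) 0]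
    exact subset_convexHull ℝ _ (by simp [trivialComplex])⟩

theorem isTorusComplex_cubeComplex (r : ℕ) : (cubeComplex r).IsTorusComplex
    (AddSubgroup.pi Set.univ fun _ : Fin r => AddSubgroup.zmultiples (1 : ℝ)) := by
  induction r with
  | zero => exact isTorusComplex_trivialComplex _
  | succ r ih =>
    refine ih.raise 0 zero_lt_one fun l => ?_
    rw [mem_pi_zmultiples_iff (fun _ => (1 : ℝ))]
    simp

theorem cubeComplex_integral (r : ℕ) :
    ∀ α, ∀ v ∈ (cubeComplex r).vt α, ∀ i, ∃ m : ℤ, v i = m := by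
  induction r with
  | zero => exact fun _ _ _ i => i.elim0
  | succ r ih => exact OrderedComplex.raise_integral ih

theorem card_cubeComplex_index (r : ℕ) :
    Finite (cubeComplex r).Index ∧ Nat.card (cubeComplex r).Index = r.factorial := by
  induction r with
  | zero => exact ⟨inferInstanceAs (Finite Unit), Nat.card_unique (α := Unit)⟩
  | succ r ih =>
    have := ih.1
    refine ⟨OrderedComplex.finite_raise_index, ?_⟩
    refine (OrderedComplex.card_raise_index (isTorusComplex_cubeComplex r).card_vt).trans ?_
    rw [ih.2, Nat.factorial_succ]
    simp [mul_comm]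

section Tower

variable (r r₂ : ℕ) (N : Fin r₂ → ℕ) (θ : Fin r₂ → Fin r → ℝ)

theorem isTorusComplex_towerComplex (hN : ∀ i, 0 < N i) : ∀ (j : ℕ) (h : j ≤ r₂),
    (towerComplex r r₂ N θ j h).IsTorusComplex (boxLattice r fun i : Fin j => N (Fin.castLE h i))
  | 0, h => by
    have : boxLattice r (fun i : Fin 0 => N (Fin.castLE h i)) =
        AddSubgroup.pi Set.univ fun _ : Fin r => AddSubgroup.zmultiples (1 : ℝ) :=
      AddSubgroup.ext (mem_boxLattice_zero_iff r _)
    rw [this]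
    exact isTorusComplex_cubeComplex r
  | j + 1, h => by
    refine (isTorusComplex_towerComplex hN j (Nat.le_of_succ_le h)).raise
      (argForm r j (N ⟨j, h⟩) (θ ⟨j, h⟩)) (by exact_mod_cast hN _) fun l => ?_
    refine (mem_boxLattice_succ_iff r (fun i : Fin (j + 1) => N (Fin.castLE h i)) l).trans ?_
    simp only [Int.cast_zero, sub_zero, Int.cast_natCast]
    rfl

theorem towerComplex_integral : ∀ (j : ℕ) (h : j ≤ r₂),
    ∀ α, ∀ v ∈ (towerComplex r r₂ N θ j h).vt α, ∀ i, ∃ m : ℤ, v i = m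
  | 0, _ => cubeComplex_integral r
  | j + 1, h => OrderedComplex.raise_integral (towerComplex_integral j (Nat.le_of_succ_le h))

theorem card_towerComplex_index (hN : ∀ i, 0 < N i) : ∀ (j : ℕ) (h : j ≤ r₂),
    Finite (towerComplex r r₂ N θ j h).Index ∧ Nat.card (towerComplex r r₂ N θ j h).Index =
      (r + j).factorial * ∏ i : Fin j, N (Fin.castLE h i)
  | 0, _ => ⟨(card_cubeComplex_index r).1, by
      rw [Fin.prod_univ_zero, mul_one]
      exact (card_cubeComplex_index r).2⟩
  | j + 1, h => by
    have ih := card_towerComplex_index hN j (Nat.le_of_succ_le h)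
    have := ih.1
    refine ⟨OrderedComplex.finite_raise_index, ?_⟩
    refine (OrderedComplex.card_raise_index
      (isTorusComplex_towerComplex r r₂ N θ hN j _).card_vt).trans ?_
    have hinit : ∀ i : Fin j, Fin.castLE h i.castSucc = Fin.castLE (Nat.le_of_succ_le h) i :=
      fun _ => rfl
    have hlast : Fin.castLE h (Fin.last j) = ⟨j, h⟩ := rfl
    rw [ih.2, Fin.prod_univ_castSucc, ← add_assoc, Nat.factorial_succ, sub_zero, Int.toNat_natCast]
    simp only [hinit, hlast]
    ring

theorem argForm_dropLast (j n : ℕ) (η : Fin r → ℝ) (ρ : Fin (r + j + 1) → ℝ) :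
    argForm r (j + 1) n η ρ = argForm r j n η (dropLast ρ) := by
  simp only [argForm, LinearMap.smul_apply, LinearMap.sum_apply, LinearMap.proj_apply]
  rfl

/-- For the newest coordinate this is the level bound. Later raisings preserve it, since the form
reads only the first `r` coordinates and `dropLast` leaves the earlier ones unchanged. -/
theorem towerComplex_exists_mem_Icc : ∀ (j : ℕ) (h : j ≤ r₂) (i : Fin j),
    ∀ α, ∃ a : ℝ, ∀ ρ ∈ (towerComplex r r₂ N θ j h).vt α,
      ρ (Fin.natAdd r i) + argForm r j (N (Fin.castLE h i)) (θ (Fin.castLE h i)) ρ ∈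
        Set.Icc a (a + 1)
  | 0, _, i => i.elim0
  | j + 1, h, i => by
    intro γ
    refine Fin.lastCases ?_ (fun i => ?_) i
    · obtain ⟨a, ha⟩ := OrderedComplex.exists_level_mem_Icc
        (X := towerComplex r r₂ N θ j (Nat.le_of_succ_le h)) γ
      refine ⟨a, fun ρ hρ => ?_⟩
      have := ha ρ hρ
      rw [OrderedComplex.level_apply, add_comm (argForm _ _ _ _ _)] at this
      rw [argForm_dropLast]
      exact this
    · obtain ⟨a, ha⟩ := towerComplex_exists_mem_Icc j (Nat.le_of_succ_le h) i γ.1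
      refine ⟨a, fun ρ hρ => ?_⟩
      rw [argForm_dropLast]
      exact ha (dropLast ρ) (OrderedComplex.dropLast_mem_vt hρ)

end Tower

/-! ### The number field and the final assembly. -/

theorem NumberField.rank_add_nrComplexPlaces_add_one (K : Type*) [Field K] [NumberField K] :
    NumberField.Units.rank K + NumberField.InfinitePlace.nrComplexPlaces K + 1 =
      Module.finrank ℚ K := by
  have h1 := NumberField.InfinitePlace.card_add_two_mul_card_eq_rank K
  have h2 := NumberField.InfinitePlace.card_eq_nrRealPlaces_add_nrComplexPlaces K
  have h3 : 0 < Fintype.card (NumberField.InfinitePlace K) := Fintype.card_pos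
  unfold NumberField.Units.rank
  omega

theorem proposition2 (K : Type*) [Field K] [NumberField K]
    (τ : Fin (NumberField.InfinitePlace.nrComplexPlaces K) → K →+* ℂ)
    (hτ : Set.BijOn (fun j => NumberField.InfinitePlace.mk (τ j)) Set.univ
      {w : NumberField.InfinitePlace K | w.IsComplex})
    (ε : Fin (NumberField.Units.rank K) → (NumberField.RingOfIntegers K)ˣ)
    (hεpos : ∀ ℓ, ∀ φ : K →+* ℝ, 0 < φ ((ε ℓ : NumberField.RingOfIntegers K) : K))
    (hεind : LinearIndependent ℤ (fun ℓ => Additive.ofMul (ε ℓ)))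
    (N : Fin (NumberField.InfinitePlace.nrComplexPlaces K) → ℕ) (hN : ∀ j, 3 ≤ N j) :
    NumberField.Units.rank K + NumberField.InfinitePlace.nrComplexPlaces K + 1 =
        Module.finrank ℚ K ∧
    (bigComplex τ ε N).IsLambdaComplex (boxLattice (NumberField.Units.rank K) N) ∧
    (∀ α, ∀ v ∈ (bigComplex τ ε N).vt α, ∀ i, ∃ m : ℤ, v i = m) ∧
    (Nat.card (bigComplex τ ε N).Index =
        (Module.finrank ℚ K - 1).factorial * ∏ j, N j ∧
      Function.Injective (bigComplex τ ε N).simplex) ∧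
    (∀ j, ∀ α, ∃ a : ℝ, ∀ κ ∈ (bigComplex τ ε N).simplex α,
      a ≤ twistedArg τ ε N j κ ∧ twistedArg τ ε N j κ ≤ a + 1) := by
  have hpos : ∀ j, 0 < N j := fun j => by have := hN j; omega
  have hrank := NumberField.rank_add_nrComplexPlaces_add_one K
  have hX : (bigComplex τ ε N).IsTorusComplex (boxLattice (NumberField.Units.rank K) N) :=
    isTorusComplex_towerComplex _ _ N (unitArg τ ε) hpos _ le_rfl
  refine ⟨hrank, hX.isLambdaComplex (discreteTopology_boxLattice _ N)
    (span_boxLattice _ N fun j => (hpos j).ne'), towerComplex_integral _ _ N _ _ le_rfl,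
    ⟨?_, hX.simplex_injective⟩, fun j α => ?_⟩
  · rw [← hrank, Nat.add_sub_cancel]
    exact (card_towerComplex_index _ _ N (unitArg τ ε) hpos _ le_rfl).2
  · obtain ⟨a, ha⟩ := towerComplex_exists_mem_Icc _ _ N (unitArg τ ε) _ le_rfl j α
    refine ⟨a, fun κ hκ => ?_⟩
    -- `Ω_j` is linear, so its bound on the vertices extends to their convex hull.
    set F := LinearMap.proj (R := ℝ) (φ := fun _ => ℝ) (Fin.natAdd (NumberField.Units.rank K) j) +
      argForm _ _ (N j) (unitArg τ ε j) with hF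
    have hmem : κ ∈ F ⁻¹' Set.Icc a (a + 1) :=
      convexHull_min (fun ρ hρ => ha ρ hρ) ((convex_Icc a (a + 1)).linear_preimage F) hκ
    have hval : F κ = twistedArg τ ε N j κ := by
      simp only [hF, argForm, twistedArg, LinearMap.add_apply, LinearMap.smul_apply,
        LinearMap.sum_apply, LinearMap.proj_apply, smul_eq_mul]
      congr 2
      exact Finset.sum_congr rfl fun ℓ _ => mul_comm _ _
    rw [Set.mem_preimage, hval] at hmem
    exact hmem
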